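/- Let $A$ be a deterministic finite automaton (initial state, set of accepting states, and a possibly partial transition function) over a finite alphabet $\Sigma$, accepting a language $L$. For $k\ge 1$ call $A$ $k$-testable if any two nonempty words $u,v\in\Sigma^+$ which have the same prefix of length $k-1$, the same suffix of length $k-1$ (the prefix or suffix being the whole word if the word is shorter) and the same set of factors of length $k$ are either both in $L$ or both not in $L$. The automaton is locally testable if it is $k$-testable for some $k\ge 1$; the least such $k$ is its order of local testability. The automaton is reduced if every state is reachable from the initial state and distinct states $p\neq q$ are inequivalent, i.e. the sets of words leading from $p$, respectively from $q$, to an accepting state are different. Theorem. There is an algorithm (a multi-tape Turing machine, i.e. a machine with finitely many stacks) which, given (a description by its transition table of) a reduced deterministic finite automaton whose state transition graph is strongly connected, decides whether the automaton is locally testable and, if so, outputs its order of local testability, in time polynomial in the length of the description. -/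

import Mathlib

/-- A deterministic finite automaton with state set `Fin n` over the alphabet `Fin m`, with an
initial state and a set of accepting states. The transition function may be partial:
`step p a = none` means that there is no edge labelled `a` out of `p`. -/
structure FinAutomaton where
  n : ℕ
  m : ℕ
  step : Fin n → Fin m → Option (Fin n)
  start : Fin n
  accept : Fin n → Bool

/-- `prefixOf k w` is the prefix of `w` of length `k`, or `w` itself if `w` is shorter. -/
def prefixOf {α : Type} (k : ℕ) (w : List α) : List α := w.take k

/-- `suffixOf k w` is the suffix of `w` of length `k`, or `w` itself if `w` is shorter. -/
def suffixOf {α : Type} (k : ℕ) (w : List α) : List α := w.drop (w.length - k)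

/-- The set of factors (contiguous subwords) of `w` of length `k`. -/
def factorsOf {α : Type} (k : ℕ) (w : List α) : Set (List α) :=
  {x | x.length = k ∧ x <:+: w}

/-- `L` is `k`-testable (for `k ≥ 1`): membership of a nonempty word depends only on its prefix and
suffix of length `k - 1` and on its set of factors of length `k`. -/
def IsKTestable {α : Type} (k : ℕ) (L : Language α) : Prop :=
  ∀ u v : List α, u ≠ [] → v ≠ [] →
    prefixOf (k - 1) u = prefixOf (k - 1) v →
    suffixOf (k - 1) u = suffixOf (k - 1) v →
    factorsOf k u = factorsOf k v →
    (u ∈ L ↔ v ∈ L)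

namespace FinAutomaton

/-- The state reached from `p` by reading `w`, if all the edges needed exist. -/
def run (A : FinAutomaton) (p : Fin A.n) (w : List (Fin A.m)) : Option (Fin A.n) :=
  w.foldlM A.step p

/-- The words that lead from `p` to an accepting state. -/
def languageFrom (A : FinAutomaton) (p : Fin A.n) : Language (Fin A.m) :=
  {w | ∃ q, A.run p w = some q ∧ A.accept q = true}

/-- The language accepted by the automaton. -/
def language (A : FinAutomaton) : Language (Fin A.m) := A.languageFrom A.start

/-- Every state is reachable from every state in the state transition graph. -/
def IsStronglyConnected (A : FinAutomaton) : Prop :=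
  ∀ p q : Fin A.n, ∃ w, A.run p w = some q

/-- Every state is reachable from the initial state, and distinct states are inequivalent. -/
def IsReduced (A : FinAutomaton) : Prop :=
  (∀ q : Fin A.n, ∃ w, A.run A.start w = some q) ∧
    ∀ p q : Fin A.n, A.languageFrom p = A.languageFrom q → p = q

open Classical in
/-- The order of local testability: `some k` if `k` is the least positive integer for which the
accepted language is `k`-testable, and `none` if the automaton is not locally testable. -/
noncomputable def order (A : FinAutomaton) : Option ℕ :=
  if h : ∃ k, 1 ≤ k ∧ IsKTestable k A.language then some (Nat.find h) else none

end FinAutomaton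

/-- The number `k` in self-delimiting unary: `k` ones followed by a zero. -/
def encodeUnary (k : ℕ) : List Bool := List.replicate k true ++ [false]

/-- `none` is written as the number `0` and `some k` as the number `k + 1`. -/
def encodeOptionNat : Option ℕ → List Bool
  | none => encodeUnary 0
  | some k => encodeUnary (k + 1)

/-- The description of an automaton as a bit string: the number of states, the number of letters,
the initial state, the list of acceptance flags, and the transition table, row by row. (The table
has `n * m` entries, each of at most `n + 1` bits, so that writing state names in unary changes the
input length only polynomially.) -/
def FinAutomaton.encode (A : FinAutomaton) : List Bool :=
  encodeUnary A.n ++ encodeUnary A.m ++ encodeUnary A.start ++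
    (List.finRange A.n).map A.accept ++
    (List.finRange A.n).flatMap fun p =>
      (List.finRange A.m).flatMap fun a => encodeOptionNat ((A.step p a).map Fin.val)

/-! Say that a word splits if it leads two states to two different states. For a reduced, strongly
connected automaton, the language is (j+1)-testable exactly when no word of length j splits
(`isKTestable_succ_iff`).

Suppose y has length j and leads p to p' and q to q' ≠ p'. Strong connectedness gives t from the
initial state to p, x from p' to q and w from q' to p. For every r, the words t y x y w y r and t y
x y w y x y r agree in their prefixes and suffixes of length j. They also have the same factors of
length j+1, because such a factor cannot stick out of an occurrence of y on both sides and so lies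
in ty, yxy, ywy or yr. The first word continues with r from p', the second with r from q'.
Testability would therefore make p' and q' equivalent, against reducedness. Conversely, if no word
of length j splits, the last j letters read determine the current state. The factors of length j+1
then decide which edges exist, and the suffix decides acceptance.

Let E_j be the set of pairs of states split by some word of length j. A pair is in E_{j+1} iff some
letter takes it into E_j, and E_1 ⊆ E_0 by determinism. So the sequence decreases, and it is
constant once two consecutive terms agree. With n states, if E_j is nonempty for j = n², then it is
nonempty for all j. Hence the order is one more than the number of j with E_j nonempty, and it is
undefined if some E_j with j ≥ n² is nonempty (`order_eq`). Only the transition table is needed to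
compute it.

The tables of the E_j are filled in by a program over registers and arrays whose loops all run N
times, N being the input length. Each basic step raises the bound on the stored numbers by at most
one, so unary storage on stacks costs only polynomial time (`runs_compile`). Stack programs in turn
are Turing machine code with the same step count (`Runs.evalsTo`). -/

/-! ### Structured programs over finitely many stacks of bits -/

/-- Structured programs acting on stacks of bits indexed by `K`, with one variable that holds the
bit popped last (`none` if the stack was empty). -/
inductive StackProgram (K : Type) : Type
  | skip : StackProgram K
  | push : K → (Option Bool → Bool) → StackProgram K
  | pop : K → StackProgram K
  | seq : StackProgram K → StackProgram K → StackProgram K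
  | ite : (Option Bool → Bool) → StackProgram K → StackProgram K → StackProgram K
  | whileDo : (Option Bool → Bool) → StackProgram K → StackProgram K

namespace StackProgram

open Turing Function StateTransition

variable {K : Type} [DecidableEq K]

/-- `Runs P v S v' S' t`: started with variable `v` and stacks `S`, the program `P` terminates
within `t` steps with variable `v'` and stacks `S'`. -/
inductive Runs : StackProgram K → Option Bool → (K → List Bool) → Option Bool →
    (K → List Bool) → ℕ → Prop
  | skip (v S) : Runs skip v S v S 1
  | push (k f v S) : Runs (push k f) v S v (update S k (f v :: S k)) 1
  | pop (k v S) : Runs (pop k) v S (S k).head? (update S k (S k).tail) 1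
  | seq {P Q v S v₁ S₁ v₂ S₂ t₁ t₂} : Runs P v S v₁ S₁ t₁ → Runs Q v₁ S₁ v₂ S₂ t₂ →
      Runs (seq P Q) v S v₂ S₂ (t₁ + t₂)
  | ite_true {c P Q v S v₁ S₁ t} : c v = true → Runs P v S v₁ S₁ t →
      Runs (ite c P Q) v S v₁ S₁ (t + 1)
  | ite_false {c P Q v S v₁ S₁ t} : c v = false → Runs Q v S v₁ S₁ t →
      Runs (ite c P Q) v S v₁ S₁ (t + 1)
  | while_false {c P v S} : c v = false → Runs (.whileDo c P) v S v S 1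
  | while_true {c P v S v₁ S₁ v₂ S₂ t₁ t₂} : c v = true → Runs P v S v₁ S₁ t₁ →
      Runs (.whileDo c P) v₁ S₁ v₂ S₂ t₂ → Runs (.whileDo c P) v S v₂ S₂ (t₁ + t₂ + 1)
  | mono {P v S v₁ S₁ t t'} : Runs P v S v₁ S₁ t → t ≤ t' → Runs P v S v₁ S₁ t'

/-- The control points of a program. -/
def Label : StackProgram K → Type
  | .skip => Unit
  | .push _ _ => Unit
  | .pop _ => Unit
  | .seq P Q => P.Label ⊕ Q.Label
  | .ite _ P Q => Option (P.Label ⊕ Q.Label)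
  | .whileDo _ P => Option P.Label

instance instFintypeLabel : (P : StackProgram K) → Fintype P.Label
  | .skip => inferInstanceAs (Fintype Unit)
  | .push _ _ => inferInstanceAs (Fintype Unit)
  | .pop _ => inferInstanceAs (Fintype Unit)
  | .seq P Q => by
      have := instFintypeLabel P
      have := instFintypeLabel Q
      exact inferInstanceAs (Fintype (P.Label ⊕ Q.Label))
  | .ite _ P Q => by
      have := instFintypeLabel P
      have := instFintypeLabel Q
      exact inferInstanceAs (Fintype (Option (P.Label ⊕ Q.Label)))
  | .whileDo _ P => by
      have := instFintypeLabel P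
      exact inferInstanceAs (Fintype (Option P.Label))

/-- The control point at which a program is entered. -/
def entry : (P : StackProgram K) → P.Label
  | .skip => ()
  | .push _ _ => ()
  | .pop _ => ()
  | .seq P _ => Sum.inl P.entry
  | .ite _ _ _ => none
  | .whileDo _ _ => none

/-- The machine code of a program whose labels are embedded by `emb` into the labels `Λ` of a
machine and which jumps to `exit` at the end. -/
def code {Λ : Type} : (P : StackProgram K) → (P.Label → Λ) → Λ → P.Label →
    TM2.Stmt (fun _ : K => Bool) Λ (Option Bool)
  | .skip, _, exit, _ => .goto fun _ => exit
  | .push k f, _, exit, _ => .push k f (.goto fun _ => exit)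
  | .pop k, _, exit, _ => .pop k (fun _ b => b) (.goto fun _ => exit)
  | .seq P Q, emb, exit, l => match l with
    | .inl l => P.code (fun l => emb (.inl l)) (emb (.inr Q.entry)) l
    | .inr l => Q.code (fun l => emb (.inr l)) exit l
  | .ite c P Q, emb, exit, l => match l with
    | none => .branch c (.goto fun _ => emb (some (.inl P.entry)))
        (.goto fun _ => emb (some (.inr Q.entry)))
    | some (.inl l) => P.code (fun l => emb (some (.inl l))) exit l
    | some (.inr l) => Q.code (fun l => emb (some (.inr l))) exit l
  | .whileDo c P, emb, exit, l => match l with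
    | none => .branch c (.goto fun _ => emb (some P.entry)) (.goto fun _ => exit)
    | some l => P.code (fun l => emb (some l)) (emb none) l

/-- Induction on the run. The embedding `emb` and the exit label are arbitrary because a subprogram
is executed inside the machine of the whole program: the first part of a sequence exits to the entry
of the second, and a loop body exits to the loop test. -/
theorem Runs.evalsTo {Λ : Type} (M : Λ → TM2.Stmt (fun _ : K => Bool) Λ (Option Bool))
    {P : StackProgram K} {v S v' S' t} (h : Runs P v S v' S' t) (emb : P.Label → Λ) (exit : Λ)
    (hM : ∀ l, M (emb l) = P.code emb exit l) :
    Nonempty (EvalsToInTime (TM2.step M) ⟨some (emb P.entry), v, S⟩ (some ⟨some exit, v', S'⟩) t) := by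
  have one : ∀ {a b : TM2.Cfg (fun _ : K => Bool) Λ (Option Bool)}, TM2.step M a = some b →
      Nonempty (EvalsToInTime (TM2.step M) a (some b) 1) :=
    fun h => ⟨⟨⟨1, h⟩, le_rfl⟩⟩
  induction h generalizing exit with
  | skip v S => exact one (by simp [TM2.step, hM, code])
  | push k f v S => exact one (by simp [TM2.step, hM, code])
  | pop k v S => exact one (by simp [TM2.step, hM, code])
  | @seq P Q _ _ _ _ _ _ _ _ _ _ ih₁ ih₂ =>
    obtain ⟨h₁⟩ := ih₁ (fun l => emb (Sum.inl l)) (emb (Sum.inr Q.entry)) fun l => hM (Sum.inl l)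
    obtain ⟨h₂⟩ := ih₂ (fun l => emb (Sum.inr l)) exit fun l => hM (Sum.inr l)
    rw [Nat.add_comm]
    exact ⟨h₁.trans _ _ _ _ _ _ h₂⟩
  | @ite_true c P Q v S _ _ _ hc _ ih =>
    have e : M (emb none) = .branch c (.goto fun _ => emb (some (Sum.inl P.entry)))
        (.goto fun _ => emb (some (Sum.inr Q.entry))) := hM none
    obtain ⟨h₁⟩ := one (a := ⟨some (emb none), v, S⟩)
      (b := ⟨some (emb (some (Sum.inl P.entry))), v, S⟩) (by simp [TM2.step, e, hc])
    obtain ⟨h₂⟩ := ih (fun l => emb (some (Sum.inl l))) exit fun l => hM (some (Sum.inl l))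
    exact ⟨h₁.trans _ _ _ _ _ _ h₂⟩
  | @ite_false c P Q v S _ _ _ hc _ ih =>
    have e : M (emb none) = .branch c (.goto fun _ => emb (some (Sum.inl P.entry)))
        (.goto fun _ => emb (some (Sum.inr Q.entry))) := hM none
    obtain ⟨h₁⟩ := one (a := ⟨some (emb none), v, S⟩)
      (b := ⟨some (emb (some (Sum.inr Q.entry))), v, S⟩) (by simp [TM2.step, e, hc])
    obtain ⟨h₂⟩ := ih (fun l => emb (some (Sum.inr l))) exit fun l => hM (some (Sum.inr l))
    exact ⟨h₁.trans _ _ _ _ _ _ h₂⟩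
  | @while_false c P v S hc =>
    have e : M (emb none) = .branch c (.goto fun _ => emb (some P.entry))
        (.goto fun _ => exit) := hM none
    exact one (a := ⟨some (emb none), v, S⟩) (by simp [TM2.step, e, hc])
  | @while_true c P v S _ _ _ _ _ _ hc _ _ ih₁ ih₂ =>
    have e : M (emb none) = .branch c (.goto fun _ => emb (some P.entry))
        (.goto fun _ => exit) := hM none
    obtain ⟨h₁⟩ := one (a := ⟨some (emb none), v, S⟩) (b := ⟨some (emb (some P.entry)), v, S⟩)
      (by simp [TM2.step, e, hc])
    obtain ⟨h₂⟩ := ih₁ (fun l => emb (some l)) (emb none) fun l => hM (some l)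
    obtain ⟨h₃⟩ := ih₂ emb exit hM
    have := (h₁.trans _ _ _ _ _ _ h₂).trans _ _ _ _ _ _ h₃
    exact ⟨⟨this.toEvalsTo, by have := this.steps_le_m; omega⟩⟩
  | mono _ hle ih =>
    obtain ⟨h⟩ := ih emb exit hM
    exact ⟨⟨h.toEvalsTo, h.steps_le_m.trans hle⟩⟩

/-- The machine that runs a program, with input stack `k₀` and output stack `k₁`. -/
def machine [Fintype K] (P : StackProgram K) (k₀ k₁ : K) : FinTM2 where
  K := K
  k₀ := k₀
  k₁ := k₁
  Γ _ := Bool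
  Λ := Option P.Label
  main := some P.entry
  σ := Option Bool
  initialState := none
  m
    | none => .halt
    | some l => P.code some none l

/-- The halting configuration of a machine has its variable in the initial state and every stack but
the output empty. This is why the run is required to clean up after itself. -/
theorem nonempty_computableInPolyTime [Fintype K] (P : StackProgram K) (k₀ k₁ : K)
    {α β : Type} (ea : α → List Bool) (eb : β → List Bool) (f : α → β) (p : Polynomial ℕ)
    (h : ∀ a, Runs P none (update (fun _ => []) k₀ (ea a)) none
      (update (fun _ => []) k₁ (eb (f a))) (p.eval (ea a).length)) :
    Nonempty (TM2ComputableInPolyTime ea eb f) := by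
  refine ⟨⟨⟨machine P k₀ k₁, Equiv.refl Bool, Equiv.refl Bool⟩, p + 1, fun a => Classical.choice ?_⟩⟩
  obtain ⟨h₁⟩ := (h a).evalsTo (machine P k₀ k₁).m some none fun l => rfl
  -- The exit label `none` carries the halt instruction; executing it is the one step added to `p`.
  have h₂ : EvalsToInTime (TM2.step (machine P k₀ k₁).m)
      ⟨some none, none, update (fun _ => []) k₁ (eb (f a))⟩
      (some ⟨none, none, update (fun _ => []) k₁ (eb (f a))⟩) 1 := ⟨⟨1, rfl⟩, le_rfl⟩
  have h₃ := h₁.trans _ _ _ _ _ _ h₂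
  have key : ∀ (k : K) (l : List Bool), (fun k' => @dite (List Bool) (k' = k)
      (‹DecidableEq K› k' k) (fun h => l) fun _ => []) = update (fun _ => []) k l := by
    intro k l
    funext k'
    by_cases hk : k' = k
    · subst hk; simp
    · simp [hk]
  have e₁ : initList (machine P k₀ k₁) (ea a) =
      ⟨some (some P.entry), none, update (fun _ => []) k₀ (ea a)⟩ :=
    congrArg (TM2.Cfg.mk (some (some P.entry)) none) (key k₀ (ea a))
  have e₂ : haltList (machine P k₀ k₁) (eb (f a)) =
      ⟨none, none, update (fun _ => []) k₁ (eb (f a))⟩ :=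
    congrArg (TM2.Cfg.mk none none) (key k₁ (eb (f a)))
  have h₄ : EvalsToInTime (TM2.step (machine P k₀ k₁).m)
      (initList (machine P k₀ k₁) (ea a)) (some (haltList (machine P k₀ k₁) (eb (f a))))
      ((p + 1).eval (ea a).length) := by
    rw [e₁, e₂]
    refine ⟨h₃.toEvalsTo, h₃.steps_le_m.trans ?_⟩
    simp only [Polynomial.eval_add, Polynomial.eval_one]
    omega
  have h₅ : TM2OutputsInTime (machine P k₀ k₁) (List.map id (ea a))
      (some (List.map id (eb (f a)))) ((p + 1).eval (ea a).length) := by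
    erw [List.map_id, List.map_id]
    exact h₄
  exact ⟨h₅⟩

end StackProgram

/-! ### Popping loops and numbers in unary on stacks -/

namespace StackProgram

open Function

section Drain

variable {K : Type} [DecidableEq K]

theorem Runs.congr {P : StackProgram K} {v S v' S' t v'' S'' t'} (h : Runs P v S v' S' t)
    (hv : v' = v'') (hS : S' = S'') (ht : t ≤ t') : Runs P v S v'' S'' t' := by
  subst hv hS; exact h.mono ht

/-- Pop the stack `k` and run `B` as long as the popped value satisfies `c`. -/
def drain (c : Option Bool → Bool) (k : K) (B : StackProgram K) : StackProgram K :=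
  .seq (.pop k) (.whileDo c (.seq B (.pop k)))

/-- Each round costs `t` for the body, one step for the next pop and one for the test. The loop also
pops the value that stops it, so a delimiter after `pre` is consumed and is left in the variable.
The body may use the other stacks freely as long as the invariant fixes the contents of `k`. -/
theorem runs_drain_of_invariant (c : Option Bool → Bool) (k : K) (B : StackProgram K)
    (pre tail : List Bool) (Inv : ℕ → (K → List Bool) → Prop) (t : ℕ)
    (hpre : ∀ b ∈ pre, c (some b) = true) (htail : c tail.head? = false)
    (hInv : ∀ j S, Inv j S → S k = pre.drop j ++ tail)
    (hB : ∀ j (hj : j < pre.length) S, Inv j S → ∃ v' S',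
      Runs B (some pre[j]) (update S k (pre.drop (j + 1) ++ tail)) v' S' t ∧ Inv (j + 1) S')
    (v : Option Bool) (S : K → List Bool) (hS : Inv 0 S) :
    ∃ S', Inv pre.length S' ∧ Runs (drain c k B) v S tail.head? (update S' k tail.tail)
      (pre.length * (t + 2) + 2) := by
  have key : ∀ i j, i + j = pre.length → ∀ S, Inv j S → ∃ S', Inv pre.length S' ∧
      Runs (.whileDo c (.seq B (.pop k))) (S k).head? (update S k (S k).tail)
        tail.head? (update S' k tail.tail) (i * (t + 2) + 1) := by
    intro i
    induction i with
    | zero =>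
      intro j hj S hS
      have h := hInv j S hS
      obtain rfl : j = pre.length := by omega
      rw [List.drop_length, List.nil_append] at h
      refine ⟨S, hS, ?_⟩
      rw [h]
      exact (Runs.while_false htail).mono (by omega)
    | succ i ih =>
      intro j hj S hS
      have hj' : j < pre.length := by omega
      have h := hInv j S hS
      rw [List.drop_eq_getElem_cons hj', List.cons_append] at h
      obtain ⟨v₁, S₁, hr, hS₁⟩ := hB j hj' S hS
      obtain ⟨S', hS', hr'⟩ := ih (j + 1) (by omega) S₁ hS₁
      refine ⟨S', hS', ?_⟩
      rw [h, List.head?_cons, List.tail_cons]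
      refine (Runs.while_true (hpre _ (List.getElem_mem hj')) (hr.seq (Runs.pop k _ _)) hr').mono ?_
      ring_nf; omega
  obtain ⟨S', hS', h⟩ := key pre.length 0 (by omega) S hS
  exact ⟨S', hS', ((Runs.pop k v S).seq h).mono (by omega)⟩

theorem runs_drain (c : Option Bool → Bool) (k : K) (B : StackProgram K)
    (pre tail : List Bool) (F : ℕ → K → List Bool) (t : ℕ)
    (hpre : ∀ b ∈ pre, c (some b) = true) (htail : c tail.head? = false)
    (hF : ∀ j, F j k = pre.drop j ++ tail)
    (hB : ∀ j (hj : j < pre.length), ∃ v',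
      Runs B (some pre[j]) (update (F j) k (pre.drop (j + 1) ++ tail)) v' (F (j + 1)) t)
    {v : Option Bool} {S S' : K → List Bool} (hS : S = F 0)
    (hS' : update (F pre.length) k tail.tail = S') :
    Runs (drain c k B) v S tail.head? S' (pre.length * (t + 2) + 2) := by
  subst hS hS'
  obtain ⟨S', rfl, h⟩ := runs_drain_of_invariant c k B pre tail (fun j S => S = F j) t hpre htail
    (by rintro j S rfl; exact hF j)
    (by rintro j hj S rfl; obtain ⟨v', h⟩ := hB j hj; exact ⟨v', _, h, rfl⟩) v (F 0) rfl
  exact h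

/-- The popped bit is `true`. -/
def isTrue (v : Option Bool) : Bool := v.getD false

/-- Empty the stack `k`. -/
def clear (k : K) : StackProgram K := drain Option.isSome k .skip

theorem runs_clear (k : K) (v S) :
    Runs (clear k) v S none (update S k []) ((S k).length * 3 + 2) :=
  runs_drain Option.isSome k .skip (S k) [] (fun j => update S k ((S k).drop j)) 1
    (by simp) (by simp) (by simp)
    (fun j hj => ⟨_, (Runs.skip _ _).congr rfl (by simp) le_rfl⟩) (by simp) (by simp)

/-- Push `true`. -/
def pushTrue (k : K) : StackProgram K := .push k fun _ => true

/-- Move the topmost block of ones from `k` to `k₁` and the following zero. -/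
def moveBlock (k k₁ : K) : StackProgram K :=
  .seq (drain isTrue k (pushTrue k₁)) (.push k₁ fun _ => false)

/-- The bit string that lists the given numbers in self-delimiting unary. -/
def encodeList (l : List ℕ) : List Bool := l.flatMap encodeUnary

@[simp] theorem encodeList_nil : encodeList [] = [] := rfl

@[simp] theorem encodeList_cons (a : ℕ) (l : List ℕ) :
    encodeList (a :: l) = List.replicate a true ++ false :: encodeList l := by
  simp [encodeList, encodeUnary]

theorem encodeList_append (l₁ l₂ : List ℕ) :
    encodeList (l₁ ++ l₂) = encodeList l₁ ++ encodeList l₂ := by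
  simp [encodeList]

/-- An exhausted stack behaves like a block encoding zero, since popping it yields `none`, which
`isTrue` rejects just like a delimiter. Arrays thus have default value zero without being padded. -/
theorem encodeList_eq (l : List ℕ) :
    ∃ tail, encodeList l = List.replicate (l.headD 0) true ++ tail ∧ isTrue tail.head? = false ∧
      tail.tail = encodeList l.tail := by
  cases l with
  | nil => exact ⟨[], by simp [isTrue]⟩
  | cons a l => exact ⟨false :: encodeList l, by simp [isTrue]⟩

theorem length_encodeList_le (l : List ℕ) (b : ℕ) (h : ∀ x ∈ l, x ≤ b) :
    (encodeList l).length ≤ l.length * (b + 1) := by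
  induction l with
  | nil => simp
  | cons a l ih =>
    have h₁ := ih fun x hx => h x (List.mem_cons_of_mem _ hx)
    have h₂ := h a List.mem_cons_self
    simp only [encodeList_cons, List.length_append, List.length_replicate, List.length_cons,
      Nat.add_mul]
    omega

theorem runs_drain_push {k k₁ : K} (hk : k ≠ k₁) (v S) (i : ℕ) (tail : List Bool)
    (h : S k = List.replicate i true ++ tail) (htail : isTrue tail.head? = false) :
    Runs (drain isTrue k (pushTrue k₁)) v S tail.head? (update (update S k tail.tail) k₁
      (List.replicate i true ++ S k₁)) (i * 3 + 2) := by
  have hk' := Ne.symm hk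
  refine (runs_drain isTrue k (pushTrue k₁) (List.replicate i true) tail
    (fun j => update (update S k ((List.replicate i true).drop j ++ tail)) k₁
      (List.replicate j true ++ S k₁)) 1 (by simp [isTrue]) htail (by simp [hk])
    (fun j hj => ⟨_, (Runs.push _ _ _ _).congr rfl ?_ le_rfl⟩) ?_ ?_).mono (by simp)
  · funext k'
    simp only [update_apply, hk', if_true, if_false, List.replicate_succ, List.cons_append]
    split_ifs <;> rfl
  · funext k'
    simp only [update_apply]
    split_ifs <;> simp_all
  · funext k'
    simp only [update_apply, List.length_replicate]
    split_ifs <;> simp_all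

/-- The targets may coincide when `i = 0`; this is needed for copying a register to itself, which
clears it first. -/
theorem runs_drain_push_push {k k₁ k₂ : K} (hk₁ : k ≠ k₁) (hk₂ : k ≠ k₂) (v S) (i : ℕ)
    (hk : i ≠ 0 → k₁ ≠ k₂) (tail : List Bool)
    (h : S k = List.replicate i true ++ tail) (htail : isTrue tail.head? = false) :
    Runs (drain isTrue k (.seq (pushTrue k₁) (pushTrue k₂))) v S tail.head?
      (update (update (update S k tail.tail) k₁ (List.replicate i true ++ S k₁)) k₂
        (List.replicate i true ++ S k₂)) (i * 4 + 2) := by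
  have hk₁' := Ne.symm hk₁
  have hk₂' := Ne.symm hk₂
  refine (runs_drain isTrue k (.seq (pushTrue k₁) (pushTrue k₂)) (List.replicate i true) tail
    (fun j => update (update (update S k ((List.replicate i true).drop j ++ tail)) k₁
      (List.replicate j true ++ S k₁)) k₂ (List.replicate j true ++ S k₂)) 2
    (by simp [isTrue]) htail (by simp [hk₁, hk₂])
    (fun j hj => ⟨_, ((Runs.push _ _ _ _).seq (Runs.push _ _ _ _)).congr rfl ?_ le_rfl⟩) ?_
      ?_).mono (by simp)
  · have hk' := hk (by rw [List.length_replicate] at hj; omega)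
    have hk'' := hk'.symm
    funext k'
    simp only [update_apply, hk₁', hk₂', hk', hk'', if_true, if_false, List.replicate_succ,
      List.cons_append]
    split_ifs <;> rfl
  · funext k'
    simp only [update_apply]
    split_ifs <;> simp_all
  · funext k'
    simp only [update_apply, List.length_replicate]
    split_ifs <;> simp_all

theorem runs_drain_skip (k : K) (v S) (i : ℕ) (tail : List Bool)
    (h : S k = List.replicate i true ++ tail) (htail : isTrue tail.head? = false) :
    Runs (drain isTrue k .skip) v S tail.head? (update S k tail.tail) (i * 3 + 2) :=
  (runs_drain isTrue k .skip (List.replicate i true) tail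
    (fun j => update S k ((List.replicate i true).drop j ++ tail)) 1 (by simp [isTrue]) htail
    (by simp) (fun j hj => ⟨_, (Runs.skip _ _).congr rfl (by simp) le_rfl⟩)
    (by simp [← h]) (by simp)).mono (by simp)

theorem runs_moveBlock {k k₁ : K} (hk : k ≠ k₁) (v S) (i : ℕ) (tail : List Bool)
    (h : S k = List.replicate i true ++ tail) (htail : isTrue tail.head? = false) :
    Runs (moveBlock k k₁) v S tail.head? (update (update S k tail.tail) k₁
      ((encodeUnary i).reverse ++ S k₁)) (i * 3 + 3) :=
  ((runs_drain_push hk v S i tail h htail).seq (Runs.push _ _ _ _)).congr rfl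
    (by simp [encodeUnary]) (by omega)

/-- Move the stack `k` to the stack `k₁`, reversing it. -/
def transfer (k k₁ : K) : StackProgram K := drain Option.isSome k (.push k₁ isTrue)

theorem runs_transfer {k k₁ : K} (hk : k ≠ k₁) (v S) :
    Runs (transfer k k₁) v S none (update (update S k []) k₁ ((S k).reverse ++ S k₁))
      ((S k).length * 3 + 2) := by
  refine runs_drain Option.isSome k (.push k₁ isTrue) (S k) []
    (fun j => update (update S k ((S k).drop j)) k₁ (((S k).take j).reverse ++ S k₁)) 1
    (by simp) (by simp) (by simp [hk])
    (fun j hj => ⟨_, (Runs.push _ _ _ _).congr rfl ?_ le_rfl⟩) ?_ ?_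
  · funext k'
    have hk' := Ne.symm hk
    simp only [update_apply, hk', if_true, if_false, List.append_nil, isTrue, Option.getD_some,
      List.take_succ_eq_append_getElem hj, List.reverse_append, List.reverse_singleton,
      List.cons_append, List.nil_append]
    split_ifs <;> rfl
  · funext k'
    grind [Function.update_apply]
  · funext k'
    grind [Function.update_apply]

/-- The first `i` entries of a list, continued by zeros. -/
def padTake (l : List ℕ) (i : ℕ) : List ℕ := (List.range i).map fun j => l.getD j 0

theorem padTake_succ (l : List ℕ) (i : ℕ) : padTake l (i + 1) = padTake l i ++ [l.getD i 0] := by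
  simp [padTake, List.range_succ]

@[simp] theorem length_padTake (l : List ℕ) (i : ℕ) : (padTake l i).length = i := by
  simp [padTake]

theorem getD_padTake_append (l r : List ℕ) (i j : ℕ) :
    (padTake l i ++ r).getD j 0 = if j < i then l.getD j 0 else r.getD (j - i) 0 := by
  split_ifs with h
  · rw [List.getD_append _ _ _ _ (by simpa using h)]
    simp [padTake, List.getD_eq_getElem?_getD, h]
  · rw [List.getD_append_right _ _ _ _ (by simpa using h)]
    simp

theorem getD_le_of_forall {l : List ℕ} {b : ℕ} (h : ∀ x ∈ l, x ≤ b) (i : ℕ) : l.getD i 0 ≤ b := by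
  rcases lt_or_ge i l.length with hi | hi
  · rw [List.getD_eq_getElem _ _ hi]; exact h _ (List.getElem_mem hi)
  · rw [List.getD_eq_default _ _ hi]; exact Nat.zero_le b

theorem padTake_le {l : List ℕ} {b : ℕ} (h : ∀ x ∈ l, x ≤ b) (i : ℕ) :
    ∀ x ∈ padTake l i, x ≤ b := by
  intro x hx
  simp only [padTake, List.mem_map] at hx
  obtain ⟨j, -, rfl⟩ := hx
  exact getD_le_of_forall h j

theorem encodeList_drop (l : List ℕ) (i : ℕ) :
    ∃ tail, encodeList (l.drop i) = List.replicate (l.getD i 0) true ++ tail ∧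
      isTrue tail.head? = false ∧ tail.tail = encodeList (l.drop (i + 1)) := by
  obtain ⟨tail, h₁, h₂, h₃⟩ := encodeList_eq (l.drop i)
  refine ⟨tail, ?_, h₂, by rw [h₃, List.tail_drop]⟩
  rw [h₁]
  congr 2
  simp [List.headD_eq_head?_getD, List.head?_drop, List.getD_eq_getElem?_getD]

/-- Move as many blocks from `a` to `s` as there are ones on `y`, consuming the latter. -/
def skipBlocks (y a s : K) : StackProgram K := drain isTrue y (moveBlock a s)

/-- Moving a block from an exhausted array pushes the block for zero, so an index beyond the stored
list pads the list on the way; hence `padTake`. The skipped part arrives reversed on `s`, and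
`transfer` later puts it back in order. -/
theorem runs_skipBlocks {y a s : K} (hya : y ≠ a) (hys : y ≠ s) (has : a ≠ s) (v S) (i b : ℕ)
    (l : List ℕ) (hy : S y = List.replicate i true) (ha : S a = encodeList l) (hs : S s = [])
    (hb : ∀ x ∈ l, x ≤ b) :
    Runs (skipBlocks y a s) v S none
      (update (update (update S y []) a (encodeList (l.drop i))) s (encodeList (padTake l i)).reverse)
      (i * (b * 3 + 5) + 2) := by
  refine (runs_drain isTrue y (moveBlock a s) (List.replicate i true) []
    (fun j => update (update (update S y ((List.replicate i true).drop j)) a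
      (encodeList (l.drop j))) s (encodeList (padTake l j)).reverse) (b * 3 + 3)
    (by simp [isTrue]) rfl (by simp [hya, hys]) (fun j hj => ?_) ?_ ?_).congr rfl rfl (by simp)
  · obtain ⟨tail, h₁, h₂, h₃⟩ := encodeList_drop l j
    refine ⟨_, (runs_moveBlock has _ _ (l.getD j 0) tail ?_ h₂).congr rfl ?_ ?_⟩
    · simp [has, hya.symm, h₁]
    · have hya' := hya.symm
      have hys' := hys.symm
      have has' := has.symm
      funext k'
      simp only [update_apply, hys', has', if_true, if_false, h₃, padTake_succ,
        List.append_nil, encodeList_append, List.reverse_append]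
      split_ifs <;> simp_all [encodeList]
    · have := getD_le_of_forall hb j
      omega
  · funext k'
    simp only [update_apply, List.drop_zero, padTake]
    split_ifs <;> simp_all
  · funext k'
    simp only [update_apply, List.length_replicate, List.tail_nil]
    split_ifs <;> simp_all

end Drain

end StackProgram

/-! ### Programs with loops of input length, over registers and arrays of numbers -/

/-- Commands acting on registers `R` and arrays `A` of natural numbers. -/
inductive LoopCommand (R A : Type) : Type
  | skip : LoopCommand R A
  | zero : R → LoopCommand R A
  | inc : R → LoopCommand R A
  | dec : R → LoopCommand R A
  | copy : R → R → LoopCommand R A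
  | read : R → A → R → LoopCommand R A
  | write : A → R → R → LoopCommand R A
  | ifZero : R → LoopCommand R A → LoopCommand R A → LoopCommand R A
  | seq : LoopCommand R A → LoopCommand R A → LoopCommand R A
  | loop : LoopCommand R A → LoopCommand R A

namespace LoopCommand

open Function StackProgram

/-- The contents of the registers and arrays. -/
structure Store (R A : Type) where
  reg : R → ℕ
  arr : A → ℕ → ℕ

variable {R A : Type} [DecidableEq R] [DecidableEq A]

/-- Assign a value to a register. -/
def Store.setReg (s : Store R A) (r : R) (v : ℕ) : Store R A := ⟨update s.reg r v, s.arr⟩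

/-- Assign a value to an array entry. -/
def Store.setArr (s : Store R A) (a : A) (i v : ℕ) : Store R A :=
  ⟨s.reg, update s.arr a (update (s.arr a) i v)⟩

/-- The effect of a command. A loop is performed `N` times. Array accesses reset the registers that
hold the index and the value to be written. -/
def eval (N : ℕ) : LoopCommand R A → Store R A → Store R A
  | .skip, s => s
  | .zero r, s => s.setReg r 0
  | .inc r, s => s.setReg r (s.reg r + 1)
  | .dec r, s => s.setReg r (s.reg r - 1)
  | .copy x y, s => (s.setReg x 0).setReg x ((s.setReg x 0).reg y)
  | .read x a y, s => (s.setReg y 0).setReg x (s.arr a (s.reg y))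
  | .write a y x, s =>
      ((s.setReg y 0).setReg x 0).setArr a (s.reg y) ((s.setReg y 0).reg x)
  | .ifZero r P Q, s => if s.reg r = 0 then eval N P s else eval N Q s
  | .seq P Q, s => eval N Q (eval N P s)
  | .loop P, s => (eval N P)^[N] s

/-- A bound for the number of basic steps, as a polynomial in the loop length. -/
noncomputable def cost : LoopCommand R A → Polynomial ℕ
  | .ifZero _ P Q => P.cost + Q.cost + 1
  | .seq P Q => P.cost + Q.cost
  | .loop P => .X * (P.cost + 1) + 1
  | _ => 1

/-- The stacks used to run a command. -/
inductive Key (R A : Type) : Type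
  | reg : R → Key R A
  | arr : A → Key R A
  | count : Key R A
  | pending : Key R A
  | aux₁ : Key R A
  | aux₂ : Key R A
  deriving DecidableEq, Fintype

/-- The stack program that runs a command. -/
def compile : LoopCommand R A → StackProgram (Key R A)
  | .skip => .skip
  | .zero r => clear (.reg r)
  | .inc r => pushTrue (.reg r)
  | .dec r => .pop (.reg r)
  | .copy x y => .seq (clear (.reg x)) (.seq (drain isTrue (.reg y) (pushTrue .aux₁))
      (drain isTrue .aux₁ (.seq (pushTrue (.reg x)) (pushTrue (.reg y)))))
  | .read x a y => .seq (skipBlocks (.reg y) (.arr a) .aux₂) (.seq (clear (.reg x))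
      (.seq (drain isTrue (.arr a) (.seq (pushTrue (.reg x)) (pushTrue .aux₂)))
        (.seq (.push .aux₂ fun _ => false) (transfer .aux₂ (.arr a)))))
  | .write a y x => .seq (skipBlocks (.reg y) (.arr a) .aux₂)
      (.seq (drain isTrue (.arr a) .skip) (.seq (moveBlock (.reg x) .aux₂)
        (transfer .aux₂ (.arr a))))
  | .ifZero r P Q => .seq (.pop (.reg r))
      (.ite isTrue (.seq (pushTrue (.reg r)) Q.compile) P.compile)
  | .seq P Q => .seq P.compile Q.compile
  | .loop P => .seq (.push .pending fun _ => false) (.seq (drain isTrue .count (pushTrue .aux₁))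
      (.seq (drain isTrue .aux₁ (.seq (pushTrue .count) (pushTrue .pending)))
        (drain isTrue .pending P.compile)))

/-- The stacks `S` represent the store `s`, all of whose values are at most `b`; loops are
performed `N` times, and `L` encodes the remaining iterations of the enclosing loops. -/
structure Represents (N b : ℕ) (s : Store R A) (L : List Bool) (S : Key R A → List Bool) :
    Prop where
  reg : ∀ r, S (.reg r) = List.replicate (s.reg r) true
  reg_le : ∀ r, s.reg r ≤ b
  arr : ∀ a, ∃ l, S (.arr a) = encodeList l ∧ (∀ i, l.getD i 0 = s.arr a i) ∧
    l.length ≤ b + 1 ∧ ∀ x ∈ l, x ≤ b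
  count : S .count = List.replicate N true
  pending : S .pending = L
  aux₁ : S .aux₁ = []
  aux₂ : S .aux₂ = []

variable {N b : ℕ} {s : Store R A} {L : List Bool} {S : Key R A → List Bool}

omit [DecidableEq R] [DecidableEq A] in
theorem Represents.mono (h : Represents N b s L S) {b' : ℕ} (hb : b ≤ b') :
    Represents N b' s L S where
  reg := h.reg
  reg_le r := (h.reg_le r).trans hb
  arr a := by
    obtain ⟨l, h₁, h₂, h₃, h₄⟩ := h.arr a
    exact ⟨l, h₁, h₂, by omega, fun x hx => (h₄ x hx).trans hb⟩
  count := h.count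
  pending := h.pending
  aux₁ := h.aux₁
  aux₂ := h.aux₂

theorem Represents.setReg (h : Represents N b s L S) (r : R) {v b' : ℕ} (hv : v ≤ b')
    (hb : b ≤ b') : Represents N b' (s.setReg r v) L
      (update S (.reg r) (List.replicate v true)) where
  reg r' := by
    by_cases hr : r' = r
    · subst hr; simp [Store.setReg]
    · simp [Store.setReg, hr, h.reg]
  reg_le r' := by
    by_cases hr : r' = r
    · subst hr; simpa [Store.setReg] using hv
    · simpa [Store.setReg, hr] using (h.reg_le r').trans hb
  arr a := by simpa [Store.setReg] using (h.mono hb).arr a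
  count := by simpa using h.count
  pending := by simpa using h.pending
  aux₁ := by simpa using h.aux₁
  aux₂ := by simpa using h.aux₂

/-- The new list has length at most the maximum of `i + 1` and `l.length`, so the length bound `b +
1` survives because `i ≤ b`. -/
theorem Represents.setArr (h : Represents N b s L S) (a : A) {l : List ℕ}
    (hl : S (.arr a) = encodeList l) (hs : ∀ i, l.getD i 0 = s.arr a i) (hlen : l.length ≤ b + 1)
    (hle : ∀ x ∈ l, x ≤ b) (i v : ℕ) (hi : i ≤ b) (hv : v ≤ b) :
    Represents N b (s.setArr a i v) L
      (update S (.arr a) (encodeList (padTake l i ++ v :: l.drop (i + 1)))) where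
  reg r := by simpa [Store.setArr] using h.reg r
  reg_le r := by simpa [Store.setArr] using h.reg_le r
  arr a' := by
    by_cases ha : a' = a
    · subst ha
      refine ⟨_, by rw [update_self], fun j => ?_, ?_, ?_⟩
      · rw [getD_padTake_append]
        simp only [Store.setArr, update_self, update_apply, ← hs]
        split_ifs with h₁ h₂ h₂
        · omega
        · rfl
        · simp [h₂]
        · obtain ⟨k, rfl⟩ : ∃ k, j = i + 1 + k := ⟨j - (i + 1), by omega⟩
          rw [show i + 1 + k - i = k + 1 by omega, List.getD_cons_succ]
          simp [List.getD_eq_getElem?_getD]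
      · simp; omega
      · intro x hx
        rcases List.mem_append.1 hx with hx | hx
        · exact padTake_le hle _ x hx
        · rcases List.mem_cons.1 hx with rfl | hx
          · exact hv
          · exact hle x (List.mem_of_mem_drop hx)
    · simpa [Store.setArr, ha] using h.arr a'
  count := by simpa using h.count
  pending := by simpa using h.pending
  aux₁ := by simpa using h.aux₁
  aux₂ := by simpa using h.aux₂

end LoopCommand

/-! ### Simulation of commands by stack programs, with time bounds -/

namespace LoopCommand

open Function StackProgram

variable {R A : Type} [DecidableEq R] [DecidableEq A]
variable {N b : ℕ} {s : Store R A} {L : List Bool} {S : Key R A → List Bool}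

theorem runs_zero (h : Represents N b s L S) (r : R) (v) :
    Runs (clear (.reg r)) v S none (update S (.reg r) []) (b * 3 + 2) ∧
      Represents N b (s.setReg r 0) L (update S (.reg r) []) := by
  refine ⟨(runs_clear _ _ _).mono ?_, by simpa using h.setReg r (Nat.zero_le b) le_rfl⟩
  rw [h.reg, List.length_replicate]
  have := h.reg_le r
  omega

theorem runs_copy (h : Represents N b s L S) (x y : R) (v) : ∃ v' S',
    Runs (compile (.copy x y : LoopCommand R A)) v S v' S' (b * 10 + 6) ∧
      Represents N b (eval N (.copy x y) s) L S' := by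
  obtain ⟨h₁, h₂⟩ := runs_zero h x v
  set s₁ := s.setReg x 0 with hs₁
  set i := s₁.reg y with hi
  have hib : i ≤ b := h₂.reg_le y
  have h₃ := runs_drain_push (k := .reg y) (k₁ := .aux₁) (by simp) none
    (update S (.reg x) []) i [] (by simpa using h₂.reg y) rfl
  refine ⟨_, _, (h₁.seq (h₃.seq (runs_drain_push_push (k := (Key.aux₁ : Key R A))
    (k₁ := Key.reg x) (k₂ := Key.reg y) (by simp) (by simp) none _ i ?_ [] ?_ rfl))).mono
    (by omega), ?_⟩
  -- If `x = y`, the register was cleared before being copied, so the number `i` of ones to move is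
  -- zero.
  · rintro hne heq
    cases heq
    simp [hi, hs₁, Store.setReg] at hne
  · rw [update_self, h₂.aux₁]
  have e := h₂.setReg x hib le_rfl
  convert e using 1
  · rfl
  have e₁ := h₂.reg y
  have e₂ := h₂.aux₁
  have e₃ := h₂.reg x
  have e₄ : s₁.reg x = 0 := by simp [hs₁, Store.setReg]
  rw [← hi] at e₁
  funext k
  simp only [update_apply, List.tail_nil]
  split_ifs <;> simp_all

/-- Walking to the position uses up the unary index, which explains why reading resets `y`. The
stack of the array is at most quadratic in `b`, and so is the time. -/
theorem runs_read (h : Represents N b s L S) (x : R) (a : A) (y : R) (v) : ∃ v' S',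
    Runs (compile (.read x a y : LoopCommand R A)) v S v' S' (20 * (b + 2) ^ 2) ∧
      Represents N b (eval N (.read x a y) s) L S' := by
  obtain ⟨l, hl, hs, hlen, hle⟩ := h.arr a
  set i := s.reg y with hi
  have hib : i ≤ b := h.reg_le y
  have h₁ := runs_skipBlocks (y := .reg y) (a := .arr a) (s := .aux₂) (by simp) (by simp) (by simp)
    v S i b l (h.reg y) hl h.aux₂ hle
  set S₁ := update (update (update S (.reg y) []) (.arr a) (encodeList (l.drop i))) .aux₂
    (encodeList (padTake l i)).reverse with hS₁
  have h₂ := runs_clear (.reg x) none S₁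
  have hx : (S₁ (.reg x)).length ≤ b := by
    have := h.reg x
    have := h.reg_le x
    simp only [hS₁, update_apply]
    split_ifs <;> simp_all
  obtain ⟨tail, ht₁, ht₂, ht₃⟩ := encodeList_drop l i
  set w := l.getD i 0 with hw
  have hwb : w ≤ b := getD_le_of_forall hle i
  have h₃ := runs_drain_push_push (k := .arr a) (k₁ := .reg x) (k₂ := .aux₂) (by simp) (by simp)
    none (update S₁ (.reg x) []) w (by simp) tail (by simp [hS₁, ht₁]) ht₂
  have h₄ := Runs.push .aux₂ (fun _ => false) tail.head? (update (update (update
    (update S₁ (.reg x) []) (.arr a) tail.tail) (.reg x)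
    (List.replicate w true ++ update S₁ (.reg x) [] (.reg x))) .aux₂
    (List.replicate w true ++ update S₁ (.reg x) [] .aux₂))
  have h₅ := h₁.seq (h₂.seq (h₃.seq (h₄.seq
    (runs_transfer (k := .aux₂) (k₁ := .arr a) (by simp) _ _))))
  refine ⟨_, _, h₅.mono ?_, ?_⟩
  · have hp := length_encodeList_le (padTake l i) b (padTake_le hle i)
    have hp₂ := Nat.mul_le_mul_right (b + 1) hib
    have hp₃ := Nat.mul_le_mul_right (b * 3 + 5) hib
    have hl₂ : S₁ .aux₂ = (encodeList (padTake l i)).reverse := by simp [hS₁]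
    rw [length_padTake] at hp
    simp only [update_self, ne_eq, reduceCtorEq, not_false_eq_true, update_of_ne, hl₂,
      List.length_cons, List.length_append, List.length_replicate, List.length_reverse]
    nlinarith
  · have e := (h.setArr a hl hs hlen hle i w hib hwb).setReg y (Nat.zero_le b) le_rfl
    have e' := e.setReg x hwb le_rfl
    convert e' using 1
    · rw [hw, hs]
      simp [eval, Store.setArr, Store.setReg, hi]
    · have e₂ := h.aux₂
      funext k
      simp only [hS₁, update_apply, ht₃, encodeList_append, encodeList_cons]
      split_ifs <;> simp_all

theorem runs_write (h : Represents N b s L S) (a : A) (y x : R) (v) : ∃ v' S',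
    Runs (compile (.write a y x : LoopCommand R A)) v S v' S' (20 * (b + 2) ^ 2) ∧
      Represents N b (eval N (.write a y x) s) L S' := by
  obtain ⟨l, hl, hs, hlen, hle⟩ := h.arr a
  set i := s.reg y with hi
  have hib : i ≤ b := h.reg_le y
  have h₁ := runs_skipBlocks (y := .reg y) (a := .arr a) (s := .aux₂) (by simp) (by simp) (by simp)
    v S i b l (h.reg y) hl h.aux₂ hle
  set S₁ := update (update (update S (.reg y) []) (.arr a) (encodeList (l.drop i))) .aux₂
    (encodeList (padTake l i)).reverse with hS₁
  obtain ⟨tail, ht₁, ht₂, ht₃⟩ := encodeList_drop l i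
  set w := l.getD i 0 with hw
  have hwb : w ≤ b := getD_le_of_forall hle i
  have h₂ := runs_drain_skip (.arr a) none S₁ w tail (by simp [hS₁, ht₁]) ht₂
  have e₁ := h.setReg y (v := 0) (Nat.zero_le b) le_rfl
  -- The value is read off after the index has been consumed, so for `x = y` a zero is written, as
  -- in `eval`.
  set j := (s.setReg y 0).reg x with hj
  have hjb : j ≤ b := e₁.reg_le x
  have h₃ := runs_moveBlock (k := .reg x) (k₁ := .aux₂) (by simp) tail.head?
    (update S₁ (.arr a) tail.tail) j [] (by
      have := e₁.reg x
      simp only [← hj, update_apply] at this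
      simp only [hS₁, update_apply]
      simp_all) rfl
  have h₅ := h₁.seq (h₂.seq (h₃.seq
    (runs_transfer (k := .aux₂) (k₁ := .arr a) (by simp) _ _)))
  refine ⟨_, _, h₅.mono ?_, ?_⟩
  · have hp := length_encodeList_le (padTake l i) b (padTake_le hle i)
    have hp₂ := Nat.mul_le_mul_right (b + 1) hib
    have hp₃ := Nat.mul_le_mul_right (b * 3 + 5) hib
    have hl₂ : S₁ .aux₂ = (encodeList (padTake l i)).reverse := by simp [hS₁]
    rw [length_padTake] at hp
    simp only [update_self, ne_eq, reduceCtorEq, not_false_eq_true, update_of_ne, hl₂, encodeUnary,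
      List.length_cons, List.length_append, List.length_replicate, List.length_reverse,
      List.length_nil]
    nlinarith
  · have e := (h.setArr a hl hs hlen hle i j hib hjb).setReg y (Nat.zero_le b) le_rfl
    have e' := e.setReg x (Nat.zero_le b) le_rfl
    convert e' using 1
    · rfl
    have e₂ := h.aux₂
    funext k
    simp only [hS₁, update_apply, ht₃, encodeList_append, encodeList_cons, encodeUnary]
    split_ifs <;> simp_all

omit [DecidableEq R] [DecidableEq A] in
theorem Represents.congr (h : Represents N b s L S) {L' : List Bool} {S' : Key R A → List Bool}
    (hS : ∀ k, k ≠ .pending → S' k = S k) (hL : S' .pending = L') : Represents N b s L' S' where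
  reg r := by rw [hS _ (by simp), h.reg]
  reg_le := h.reg_le
  arr a := by simpa only [hS (.arr a) (by simp)] using h.arr a
  count := by rw [hS _ (by simp), h.count]
  pending := hL
  aux₁ := by rw [hS _ (by simp), h.aux₁]
  aux₂ := by rw [hS _ (by simp), h.aux₂]

/-- Nested loops share the one stack `pending`: each loop puts a delimiter and `N` ones on top of
what the outer loops still have to do. The ones pass through `aux₁` so that `count` can be restored.
-/
theorem runs_loop_prepare (h : Represents N b s L S) (v) : ∃ v' S',
    Represents N b s (List.replicate N true ++ false :: L) S' ∧
    ∀ {P : StackProgram (Key R A)} {v₁ S₁ t}, Runs P v' S' v₁ S₁ t →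
      Runs (.seq (.push .pending fun _ => false) (.seq (drain isTrue .count (pushTrue .aux₁))
        (.seq (drain isTrue .aux₁ (.seq (pushTrue .count) (pushTrue .pending))) P))) v S v₁ S₁
        (N * 7 + 5 + t) := by
  have h₁ := Runs.push .pending (fun _ => false) v S
  have h₂ := runs_drain_push (k := .count) (k₁ := .aux₁) (by simp) v
    (update S .pending (false :: S .pending)) N [] (by simpa using h.count) rfl
  have h₃ := runs_drain_push_push (k := .aux₁) (k₁ := .count) (k₂ := .pending) (by simp) (by simp)
    none (update (update (update S .pending (false :: S .pending)) .count []) .aux₁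
      (List.replicate N true ++ update S .pending (false :: S .pending) .aux₁))
    N (by simp) [] (by simp [h.aux₁]) rfl
  refine ⟨_, _, ?_, fun hP => (h₁.seq (h₂.seq (h₃.seq hP))).mono (by omega)⟩
  have e₁ := h.count
  have e₂ := h.pending
  have e₃ := h.aux₁
  refine h.congr (fun k hk => ?_) ?_
  · simp only [update_apply, hk, if_false, List.tail_nil]
    split_ifs <;> simp_all
  · simp [e₂]

/-- The polynomial `cost` plays two roles: it bounds the number of basic steps and also the growth
of the bound `b` on all stored numbers. Every basic step then takes time at most quadratic in the
final bound. -/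
theorem runs_compile (P : LoopCommand R A) : ∀ {b : ℕ} {s : Store R A} {L : List Bool}
    {S : Key R A → List Bool}, Represents N b s L S → ∀ v, ∃ v' S',
    Runs P.compile v S v' S' (P.cost.eval N * (20 * (b + P.cost.eval N + 2) ^ 2)) ∧
      Represents N (b + P.cost.eval N) (eval N P s) L S' := by
  have pow_le : ∀ {m n : ℕ}, m ≤ n → 20 * m ^ 2 ≤ 20 * n ^ 2 := fun h =>
    Nat.mul_le_mul_left _ (Nat.pow_le_pow_left h 2)
  have atom : ∀ {b t : ℕ}, t ≤ 20 * (b + 2) ^ 2 → t ≤ 1 * (20 * (b + 1 + 2) ^ 2) := by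
    intro b t h
    have := @pow_le (b + 2) (b + 1 + 2) (by omega)
    omega
  have lin : ∀ {b : ℕ}, b * 10 + 6 ≤ 20 * (b + 2) ^ 2 := by intro b; nlinarith
  induction P with
  | skip =>
    intro b s L S h v
    simp only [cost, Polynomial.eval_one]
    exact ⟨_, _, (Runs.skip _ _).mono (atom (le_trans (by omega) lin)), h.mono (by omega)⟩
  | zero r =>
    intro b s L S h v
    simp only [cost, Polynomial.eval_one]
    obtain ⟨h₁, h₂⟩ := runs_zero h r v
    exact ⟨_, _, h₁.mono (atom (le_trans (by omega) lin)), h₂.mono (by omega)⟩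
  | inc r =>
    intro b s L S h v
    simp only [cost, Polynomial.eval_one]
    refine ⟨_, _, (Runs.push _ _ _ _).mono (atom (le_trans (by omega) lin)), ?_⟩
    have := h.reg_le r
    have e := h.setReg r (v := s.reg r + 1) (b' := b + 1) (by omega) (by omega)
    rwa [List.replicate_succ, ← h.reg] at e
  | dec r =>
    intro b s L S h v
    simp only [cost, Polynomial.eval_one]
    refine ⟨_, _, (Runs.pop _ _ _).mono (atom (le_trans (by omega) lin)), ?_⟩
    have := h.reg_le r
    have e := h.setReg r (v := s.reg r - 1) (b' := b + 1) (by omega) (by omega)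
    rwa [← List.tail_replicate, ← h.reg] at e
  | copy x y =>
    intro b s L S h v
    simp only [cost, Polynomial.eval_one]
    obtain ⟨v', S', h₁, h₂⟩ := runs_copy h x y v
    exact ⟨v', S', h₁.mono (atom lin), h₂.mono (by omega)⟩
  | read x a y =>
    intro b s L S h v
    simp only [cost, Polynomial.eval_one]
    obtain ⟨v', S', h₁, h₂⟩ := runs_read h x a y v
    exact ⟨v', S', h₁.mono (atom le_rfl), h₂.mono (by omega)⟩
  | write a y x =>
    intro b s L S h v
    simp only [cost, Polynomial.eval_one]
    obtain ⟨v', S', h₁, h₂⟩ := runs_write h a y x v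
    exact ⟨v', S', h₁.mono (atom le_rfl), h₂.mono (by omega)⟩
  | ifZero r P Q ihP ihQ =>
    intro b s L S h v
    simp only [cost, Polynomial.eval_one, Polynomial.eval_add, eval]
    set p := P.cost.eval N
    set q := Q.cost.eval N
    have e := h.reg r
    have hD : 3 ≤ 20 * (b + (p + q + 1) + 2) ^ 2 :=
      le_trans (by norm_num) (@pow_le 1 _ (by omega))
    split_ifs with hr
    · rw [hr] at e
      obtain ⟨v', S', h₁, h₂⟩ := ihP h none
      have hv : (S (.reg r)).head? = none := by rw [e]; rfl
      have hS : update S (.reg r) (S (.reg r)).tail = S := by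
        rw [e, List.replicate_zero, List.tail_nil, ← List.replicate_zero (a := true), ← e,
          update_eq_self]
      have hp := Runs.pop (.reg r) v S
      rw [hv, hS] at hp
      refine ⟨v', S', (hp.seq (Runs.ite_false rfl h₁)).mono ?_, h₂.mono (by omega)⟩
      have := Nat.mul_le_mul_left p (@pow_le (b + p + 2) (b + (p + q + 1) + 2) (by omega))
      nlinarith
    · obtain ⟨i, hi⟩ := Nat.exists_eq_succ_of_ne_zero hr
      rw [hi, List.replicate_succ] at e
      obtain ⟨v', S', h₁, h₂⟩ := ihQ h (some true)
      have hv : (S (.reg r)).head? = some true := by rw [e]; rfl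
      have hp := Runs.pop (.reg r) v S
      have hp' := Runs.push (.reg r) (fun _ => true) (some true)
        (update S (.reg r) (S (.reg r)).tail)
      rw [update_self, update_idem, e, List.tail_cons, ← e, update_eq_self] at hp'
      rw [hv, e, List.tail_cons] at hp
      refine ⟨v', S', (hp.seq (Runs.ite_true rfl (hp'.seq h₁))).mono ?_,
        h₂.mono (by omega)⟩
      have := Nat.mul_le_mul_left q (@pow_le (b + q + 2) (b + (p + q + 1) + 2) (by omega))
      nlinarith
  | seq P Q ihP ihQ =>
    intro b s L S h v
    simp only [cost, Polynomial.eval_add, eval]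
    obtain ⟨v₁, S₁, h₁, h₁'⟩ := ihP h v
    obtain ⟨v₂, S₂, h₂, h₂'⟩ := ihQ h₁' v₁
    set p := P.cost.eval N
    set q := Q.cost.eval N
    refine ⟨v₂, S₂, (h₁.seq h₂).mono ?_, by rwa [← Nat.add_assoc]⟩
    have := Nat.mul_le_mul_left p (@pow_le (b + p + 2) (b + (p + q) + 2) (by omega))
    rw [← Nat.add_assoc] at this ⊢
    nlinarith
  | loop P ih =>
    intro b s L S h v
    simp only [cost, Polynomial.eval_add, Polynomial.eval_mul, Polynomial.eval_X,
      Polynomial.eval_one, eval]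
    set p := P.cost.eval N
    obtain ⟨v', S', h₁, h₂⟩ := runs_loop_prepare h v
    -- After `j` rounds the bound has grown by `j * p`; charging every round with the final bound `b
    -- + N * p` gives a uniform time per round.
    obtain ⟨S₁, h₃, h₄⟩ := runs_drain_of_invariant isTrue .pending P.compile (.replicate N true)
      (false :: L) (fun j S => Represents N (b + j * p) ((eval N P)^[j] s)
        ((List.replicate N true).drop j ++ false :: L) S) (p * (20 * (b + N * p + 2) ^ 2))
      (by simp [StackProgram.isTrue]) rfl (fun j S h => h.pending)
      (fun j hj S h => by
        obtain ⟨v₁, S₁, hr, hs⟩ := ih (h.congr (L' := (List.replicate N true).drop (j + 1) ++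
          false :: L) (S' := update S .pending ((List.replicate N true).drop (j + 1) ++
          false :: L)) (fun k hk => by simp [hk]) (by simp)) (some (List.replicate N true)[j])
        rw [List.length_replicate] at hj
        have hjN : j * p + p ≤ N * p := by
          rw [← Nat.succ_mul]
          exact Nat.mul_le_mul_right p hj
        refine ⟨v₁, S₁, hr.mono (Nat.mul_le_mul_left p (pow_le (by omega))), ?_⟩
        rw [iterate_succ_apply']
        exact hs.mono (by rw [Nat.add_mul]; omega))
      v' S' (by simpa using h₁)
    rw [List.length_replicate] at h₃ h₄
    refine ⟨_, _, (h₂ h₄).mono ?_, (h₃.mono ?_).congr (fun k hk => by simp [hk]) (by simp)⟩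
    · have e₁ := Nat.mul_le_mul_left (N * p) (@pow_le (b + N * p + 2) (b + (N * (p + 1) + 1) + 2)
        (by nlinarith))
      have e₂ : 20 * 4 ≤ 20 * (b + (N * (p + 1) + 1) + 2) ^ 2 :=
        le_trans (by norm_num) (@pow_le 2 _ (Nat.le_add_left 2 _))
      generalize 20 * (b + (N * (p + 1) + 1) + 2) ^ 2 = D at e₁ e₂ ⊢
      nlinarith
    · nlinarith

end LoopCommand

/-! ### Input, output and passage to Turing machines -/

namespace LoopCommand

open Function StackProgram Turing

section ClearAll

variable {K : Type} [DecidableEq K]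

/-- Empty the stacks in the list `ks` and the stack `k₀`. -/
def clearAll (ks : List K) (k₀ : K) : StackProgram K :=
  ks.foldr (fun k P => .seq (clear k) P) (clear k₀)

theorem runs_clearAll (ks : List K) (k₀ : K) (B : ℕ) (v) (S : K → List Bool)
    (h₀ : (S k₀).length ≤ B) (h : ∀ k ∈ ks, (S k).length ≤ B) :
    Runs (clearAll ks k₀) v S none (fun k => if k ∈ ks ∨ k = k₀ then [] else S k)
      ((ks.length + 1) * (B * 3 + 2)) := by
  induction ks generalizing v S with
  | nil =>
    refine (runs_clear k₀ v S).congr rfl ?_ ?_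
    · funext k
      simp [update_apply]
    · simp; omega
  | cons k ks ih =>
    have le : ∀ k', (S k').length ≤ B → (update S k [] k').length ≤ B := by
      intro k' hk'
      rw [update_apply]
      split_ifs
      · simp
      · exact hk'
    refine ((runs_clear k v S).seq (ih none (update S k []) (le _ h₀)
      fun k' hk' => le _ (h k' (List.mem_cons_of_mem _ hk')))).congr rfl ?_ ?_
    · funext k'
      simp only [update_apply, List.mem_cons]
      split_ifs <;> simp_all
    · have := h k List.mem_cons_self
      rw [List.length_cons, Nat.add_mul (ks.length + 1)]
      omega

end ClearAll

variable {R A : Type} [DecidableEq R] [DecidableEq A]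

/-- The store with all registers zero, and the bits of `w` in the array `a`. -/
def inputStore (a : A) (w : List Bool) : Store R A :=
  ⟨fun _ => 0, fun a' i => if a' = a then (w.map Bool.toNat).getD i 0 else 0⟩

/-- The program that turns the input into the initial store. -/
def prepare (a : A) : StackProgram (Key R A) :=
  .seq (drain Option.isSome .aux₁ (.seq (.push .aux₂ isTrue) (pushTrue .count)))
    (drain Option.isSome .aux₂ (.seq (.push (.arr a) fun _ => false)
      (.ite isTrue (pushTrue (.arr a)) .skip)))

/-- Each stack move reverses, so two passes keep the order of the input; the first pass also counts
its length. In the second pass the delimiter is pushed before the optional one, since it lies below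
it in the unary block. -/
theorem runs_prepare (a : A) (w : List Bool) :
    Runs (prepare a : StackProgram (Key R A)) none (update (fun _ => []) .aux₁ w) none
      (update (update (fun _ => []) .count (List.replicate w.length true)) (.arr a)
        (encodeList (w.map Bool.toNat))) (w.length * 9 + 4) := by
  refine ((runs_drain Option.isSome (Key.aux₁ : Key R A)
    (.seq (.push Key.aux₂ isTrue) (pushTrue Key.count)) w []
    (fun j => update (update (update (fun _ : Key R A => []) (Key.aux₁ : Key R A) (w.drop j)) Key.aux₂
      (w.take j).reverse)
      Key.count (List.replicate j true)) 2 (by simp) rfl (by simp)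
      (fun j hj => ⟨_, ((Runs.push _ _ _ _).seq (Runs.push _ _ _ _)).congr rfl ?_ le_rfl⟩)
      ?_ rfl).seq
    (runs_drain Option.isSome (Key.aux₂ : Key R A) (.seq (.push (Key.arr a) fun _ => false)
      (.ite isTrue (pushTrue (Key.arr a)) .skip)) w.reverse []
    (fun j => update (update (update (fun _ : Key R A => []) Key.count (List.replicate w.length true))
      (Key.arr a) (encodeList ((w.reverse.take j).reverse.map Bool.toNat))) Key.aux₂
      (w.reverse.drop j)) 3 (by simp) rfl (by simp)
      (fun j hj => ?_) ?_ ?_)).congr rfl rfl (by simp; omega)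
  · funext k
    simp only [update_apply, List.take_succ_eq_append_getElem hj, StackProgram.isTrue,
      Option.getD_some, List.replicate_succ, List.append_nil, List.reverse_append]
    split_ifs <;> simp_all
  · funext k
    simp only [update_apply, List.drop_zero, List.take_zero, List.reverse_nil, List.replicate_zero]
    split_ifs <;> simp_all
  · refine ⟨some w.reverse[j], ?_⟩
    cases hb : w.reverse[j]
    · refine ((Runs.push _ _ _ _).seq (Runs.ite_false rfl (Runs.skip _ _))).congr rfl ?_ le_rfl
      funext k
      simp only [update_apply, List.take_succ_eq_append_getElem hj, hb, List.append_nil,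
        List.reverse_append, List.reverse_singleton, List.cons_append, List.nil_append,
        List.map_cons, Bool.toNat_false, encodeList_cons, List.replicate_zero]
      split_ifs <;> simp_all
    · refine ((Runs.push _ _ _ _).seq (Runs.ite_true rfl (Runs.push _ _ _ _))).congr rfl ?_ le_rfl
      funext k
      simp only [update_apply, List.take_succ_eq_append_getElem hj, hb, List.append_nil,
        List.reverse_append, List.reverse_singleton, List.cons_append, List.nil_append,
        List.map_cons, Bool.toNat_true, encodeList_cons, List.replicate_one]
      split_ifs <;> simp_all
  · funext k
    simp only [update_apply, List.tail_nil]
    split_ifs <;> simp_all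
  · funext k
    simp only [update_apply, List.tail_nil]
    rw [List.take_length, List.reverse_reverse]
    split_ifs <;> simp_all

theorem represents_inputStore (a : A) (w : List Bool) :
    Represents w.length (w.length + 1) (inputStore a w : Store R A) []
      (update (update (fun _ => []) .count (List.replicate w.length true)) (.arr a)
        (encodeList (w.map Bool.toNat))) where
  reg r := by simp [inputStore]
  reg_le r := by simp [inputStore]
  arr a' := by
    by_cases h : a' = a
    · subst h
      refine ⟨_, by rw [update_self], fun i => by simp [inputStore], by simp; omega, ?_⟩
      intro x hx
      obtain ⟨b, -, rfl⟩ := List.mem_map.1 hx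
      exact (Bool.toNat_le b).trans (by omega)
    · exact ⟨[], by simp [h], by simp [inputStore, h]⟩
  count := by simp
  pending := by simp
  aux₁ := by simp
  aux₂ := by simp

variable [Fintype R] [Fintype A]

/-- The program that writes the register `r` to the output and empties all other stacks. -/
noncomputable def finish (r : R) : StackProgram (Key R A) :=
  .seq (.push .aux₂ fun _ => false) (.seq (drain isTrue (.reg r) (pushTrue .aux₂))
    (clearAll (Finset.univ.erase Key.aux₂).toList .aux₁))

theorem runs_finish {N b : ℕ} {s : Store R A} {S : Key R A → List Bool}
    (h : Represents N b s [] S) (hN : N ≤ b) (r : R) (v) :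
    Runs (finish r) v S none (update (fun _ => []) .aux₂ (encodeUnary (s.reg r)))
      (b * 3 + 3 + (Fintype.card (Key R A) + 1) * ((b + 1) * (b + 1) * 3 + 2)) := by
  have h₁ := Runs.push .aux₂ (fun _ => false) v S
  have h₂ := runs_drain_push (k := .reg r) (k₁ := .aux₂) (by simp) v
    (update S .aux₂ (false :: S .aux₂)) (s.reg r) [] (by simp [h.reg]) rfl
  have hb : b ≤ (b + 1) * (b + 1) := by nlinarith
  -- An array occupies at most `b + 1` blocks of at most `b + 1` bits each, and all other stacks are
  -- shorter.
  have hB : ∀ k, k ≠ .aux₂ → (update (update (update S .aux₂ (false :: S .aux₂)) (.reg r)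
      [].tail) .aux₂ (List.replicate (s.reg r) true ++ update S .aux₂ (false :: S .aux₂) .aux₂)
      k).length ≤ (b + 1) * (b + 1) := by
    intro k hk
    simp only [update_apply, hk, if_false]
    split_ifs
    · simp
    · cases k with
      | reg r' => rw [h.reg, List.length_replicate]; exact (h.reg_le r').trans hb
      | arr a =>
        obtain ⟨l, hl, -, hlen, hle⟩ := h.arr a
        rw [hl]
        exact (length_encodeList_le l b hle).trans (Nat.mul_le_mul_right _ hlen)
      | count => rw [h.count, List.length_replicate]; omega
      | pending => rw [h.pending]; simp
      | aux₁ => rw [h.aux₁]; simp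
      | aux₂ => exact absurd rfl hk
  have h₃ := runs_clearAll (Finset.univ.erase (Key.aux₂ : Key R A)).toList .aux₁
    ((b + 1) * (b + 1)) none _ (hB .aux₁ (by simp))
    (fun k hk => hB k (by simpa using hk))
  refine (h₁.seq (h₂.seq h₃)).congr rfl ?_ ?_
  · have e := h.aux₂
    funext k
    simp only [Finset.mem_toList, Finset.mem_erase, Finset.mem_univ, and_true, update_apply]
    split_ifs <;> simp_all [encodeUnary]
  · have := h.reg_le r
    have := Nat.mul_le_mul_right ((b + 1) * (b + 1) * 3 + 2) (show
      (Finset.univ.erase (Key.aux₂ : Key R A)).toList.length + 1 ≤ Fintype.card (Key R A) + 1 by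
        rw [Finset.length_toList, Finset.card_erase_of_mem (Finset.mem_univ _), Finset.card_univ]
        omega)
    omega

theorem nonempty_computableInPolyTime (P : LoopCommand R A) (inp : A) (out : R) {α β : Type}
    (ea : α → List Bool) (eb : β → List Bool) (f : α → β)
    (h : ∀ a, eb (f a) = encodeUnary ((eval (ea a).length P (inputStore inp (ea a))).reg out)) :
    Nonempty (TM2ComputableInPolyTime ea eb f) := by
  refine StackProgram.nonempty_computableInPolyTime
    (.seq (prepare inp) (.seq P.compile (finish out))) .aux₁ .aux₂ ea eb f
    (.X * 9 + 4 + (P.cost * (20 * (.X + 1 + P.cost + 2) ^ 2) + ((.X + 1 + P.cost) * 3 + 3 +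
      (.C (Fintype.card (Key R A)) + 1) *
        ((.X + 1 + P.cost + 1) * (.X + 1 + P.cost + 1) * 3 + 2)))) fun a => ?_
  obtain ⟨v', S', h₁, h₂⟩ := runs_compile P (represents_inputStore inp (ea a)) none
  refine ((runs_prepare inp (ea a)).seq (h₁.seq (runs_finish h₂ (by omega) out v'))).congr rfl
    (by rw [h]) (le_of_eq ?_)
  simp only [Polynomial.eval_add, Polynomial.eval_mul, Polynomial.eval_pow, Polynomial.eval_X,
    Polynomial.eval_C, Polynomial.eval_one, Polynomial.eval_ofNat]

end LoopCommand

/-! ### Local testability of strongly connected reduced automata -/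

section Words

variable {α : Type}

theorem prefixOf_append {k : ℕ} {x : List α} (y : List α) (h : k ≤ x.length) :
    prefixOf k (x ++ y) = prefixOf k x :=
  List.take_append_of_le_length h

theorem suffixOf_append {k : ℕ} (x : List α) {y : List α} (h : k ≤ y.length) :
    suffixOf k (x ++ y) = suffixOf k y := by
  unfold suffixOf
  rw [List.length_append, Nat.add_sub_assoc h, List.drop_length_add_append]

/-- A factor one letter longer than `y` cannot extend beyond `y` on both sides. -/
theorem factorsOf_append {k : ℕ} (x y z : List α) (h : y.length + 1 = k) :
    factorsOf k (x ++ y ++ z) = factorsOf k (x ++ y) ∪ factorsOf k (y ++ z) := by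
  ext f
  simp only [factorsOf, Set.mem_ofPred_eq, Set.mem_union]
  constructor
  · rintro ⟨hf, s, t, hst⟩
    rcases Nat.lt_or_ge s.length x.length with hs | hs
    · refine Or.inl ⟨hf, ?_⟩
      have h₁ : s ++ f <+: x ++ y := by
        refine List.prefix_of_prefix_length_le (l₃ := x ++ y ++ z) ⟨t, hst⟩ ⟨z, rfl⟩ ?_
        simp only [List.length_append]
        omega
      exact (List.suffix_append s f).isInfix.trans h₁.isInfix
    · refine Or.inr ⟨hf, ?_⟩
      have h₁ : f ++ t <:+ y ++ z := by
        refine List.suffix_of_suffix_length_le (l₃ := x ++ y ++ z)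
          ⟨s, by rw [← hst, List.append_assoc]⟩ ⟨x, by rw [List.append_assoc]⟩ ?_
        have := congrArg List.length hst
        simp only [List.length_append] at this ⊢
        omega
      exact (List.prefix_append f t).isInfix.trans h₁.isInfix
  · rintro (⟨hf, h₁⟩ | ⟨hf, h₁⟩)
    · exact ⟨hf, h₁.trans (List.prefix_append _ _).isInfix⟩
    · exact ⟨hf, h₁.trans (by rw [List.append_assoc]; exact (List.suffix_append _ _).isInfix)⟩

end Words

namespace FinAutomaton

variable {A : FinAutomaton}

@[simp] theorem run_nil (p : Fin A.n) : A.run p [] = some p := rfl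

theorem run_cons (p : Fin A.n) (a : Fin A.m) (w : List (Fin A.m)) :
    A.run p (a :: w) = (A.step p a).bind fun q => A.run q w := rfl

theorem run_append (p : Fin A.n) (u v : List (Fin A.m)) :
    A.run p (u ++ v) = (A.run p u).bind fun q => A.run q v := by
  simp only [run, List.foldlM_append]; rfl

theorem run_append_of_eq_some {p q : Fin A.n} {u : List (Fin A.m)} (h : A.run p u = some q)
    (v : List (Fin A.m)) : A.run p (u ++ v) = A.run q v := by
  rw [run_append, h]; rfl

theorem mem_languageFrom {p : Fin A.n} {w : List (Fin A.m)} :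
    w ∈ A.languageFrom p ↔ ∃ q, A.run p w = some q ∧ A.accept q = true := Iff.rfl

variable (A) in
/-- Some word of length `j` leads to at least two different states. -/
def HasSplit (j : ℕ) : Prop :=
  ∃ w : List (Fin A.m), w.length = j ∧ ∃ p q p' q', A.run p w = some p' ∧ A.run q w = some q' ∧
    p' ≠ q'

/-- Testability would make the two distinct end states equivalent: a detour through the other end
state changes where a word leads but not its short prefix, suffix or factors. -/
theorem not_isKTestable_of_hasSplit (hR : A.IsReduced) (hS : A.IsStronglyConnected) {j : ℕ}
    (h : A.HasSplit j) : ¬ IsKTestable (j + 1) A.language := by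
  intro hT
  suffices key : ∀ (y : List (Fin A.m)) (p q p' q' : Fin A.n), y.length = j →
      A.run p y = some p' → A.run q y = some q' → p' ≠ q' →
      ∀ r ∈ A.languageFrom p', r ∈ A.languageFrom q' by
    obtain ⟨y, hy, p, q, p', q', hp, hq, hne⟩ := h
    exact hne (hR.2 _ _ (Set.Subset.antisymm (key y p q p' q' hy hp hq hne)
      (key y q p q' p' hy hq hp hne.symm)))
  intro y p q p' q' hy hp hq hne r hr
  -- The words compared are t y x y w y r and t y x y w y x y r, with states p, p', q, q', p, p'
  -- along the first up to r, and two more, q and q', along the second.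
  obtain ⟨t, ht⟩ := hS A.start p
  obtain ⟨x, hx⟩ := hS p' q
  obtain ⟨w, hw⟩ := hS q' p
  -- Testability speaks of nonempty words only. If x and y were both empty, then p' = q = q'.
  have hxy : x ++ y ≠ [] := by
    intro h
    obtain ⟨rfl, rfl⟩ := List.append_eq_nil_iff.1 h
    simp only [run_nil, Option.some.injEq] at hp hq hx
    exact hne (hx.trans hq)
  have split : ∀ a b : List (Fin A.m), factorsOf (j + 1) (a ++ (y ++ b)) =
      factorsOf (j + 1) (a ++ y) ∪ factorsOf (j + 1) (y ++ b) := fun a b => by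
    rw [← factorsOf_append a y b (by omega), List.append_assoc]
  have hle : j ≤ y.length := hy.ge
  have e₁ : prefixOf j (t ++ (y ++ (x ++ (y ++ (w ++ (y ++ r)))))) =
      prefixOf j (t ++ (y ++ (x ++ (y ++ (w ++ (y ++ (x ++ (y ++ r)))))))) := by
    have hl : j ≤ (t ++ y).length := by simp; omega
    simp only [← List.append_assoc t y]
    rw [prefixOf_append _ hl, prefixOf_append _ hl]
  have e₂ : suffixOf j (t ++ (y ++ (x ++ (y ++ (w ++ (y ++ r)))))) =
      suffixOf j (t ++ (y ++ (x ++ (y ++ (w ++ (y ++ (x ++ (y ++ r)))))))) := by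
    have hl : j ≤ (y ++ r).length := by simp; omega
    simp only [← List.append_assoc _ _ (y ++ r)]
    rw [suffixOf_append _ hl, suffixOf_append _ hl]
  have e₃ : factorsOf (j + 1) (t ++ (y ++ (x ++ (y ++ (w ++ (y ++ r)))))) =
      factorsOf (j + 1) (t ++ (y ++ (x ++ (y ++ (w ++ (y ++ (x ++ (y ++ r)))))))) := by
    have split' : ∀ a b : List (Fin A.m), factorsOf (j + 1) (y ++ (a ++ (y ++ b))) =
        factorsOf (j + 1) (y ++ (a ++ y)) ∪ factorsOf (j + 1) (y ++ b) := fun a b => by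
      rw [← List.append_assoc, split, List.append_assoc]
    -- Both sets become unions of the factors of ty, yxy, ywy and yr, the second with yxy repeated.
    rw [split t, split t, split' x, split' x, split' w, split' w, split' x]
    ext f
    simp only [Set.mem_union]
    tauto
  have h₁ : A.run A.start (t ++ (y ++ (x ++ (y ++ (w ++ (y ++ r)))))) = A.run p' r := by
    rw [run_append_of_eq_some ht, run_append_of_eq_some hp, run_append_of_eq_some hx,
      run_append_of_eq_some hq, run_append_of_eq_some hw, run_append_of_eq_some hp]
  have h₂ : A.run A.start (t ++ (y ++ (x ++ (y ++ (w ++ (y ++ (x ++ (y ++ r)))))))) =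
      A.run q' r := by
    rw [run_append_of_eq_some ht, run_append_of_eq_some hp, run_append_of_eq_some hx,
      run_append_of_eq_some hq, run_append_of_eq_some hw, run_append_of_eq_some hp,
      run_append_of_eq_some hx, run_append_of_eq_some hq]
  have hmem := hT _ _ (by simp at hxy ⊢; tauto) (by simp at hxy ⊢; tauto) e₁ e₂ e₃
  rw [language, mem_languageFrom, mem_languageFrom, h₁, h₂] at hmem
  exact hmem.1 hr

/-- A word of length j determines the state in which it ends, if any, so a window of j+1 letters
shows whether the automaton can continue. Neither reducedness nor strong connectedness is needed
here. -/
theorem isKTestable_of_not_hasSplit {j : ℕ} (h : ¬ A.HasSplit j) :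
    IsKTestable (j + 1) A.language := by
  have uniq : ∀ (y : List (Fin A.m)) (p q p' q' : Fin A.n), y.length = j →
      A.run p y = some p' → A.run q y = some q' → p' = q' := by
    intro y p q p' q' hy hp hq
    by_contra hne
    exact h ⟨y, hy, p, q, p', q', hp, hq, hne⟩
  suffices key : ∀ u v : List (Fin A.m), prefixOf j u = prefixOf j v →
      suffixOf j u = suffixOf j v → factorsOf (j + 1) u = factorsOf (j + 1) v →
      u ∈ A.language → v ∈ A.language from
    fun u v _ _ h₁ h₂ h₃ => ⟨key u v h₁ h₂ h₃, key v u h₁.symm h₂.symm h₃.symm⟩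
  intro u v hpre hsuf hfac hu
  -- A word of length at most j has no factor of length j+1. Two such words with the same prefix are
  -- equal, which settles the short case.
  have short : ∀ u v : List (Fin A.m), factorsOf (j + 1) u = factorsOf (j + 1) v →
      u.length ≤ j → v.length ≤ j := by
    intro u v hfac hu
    by_contra! hv
    have : v.take (j + 1) ∈ factorsOf (j + 1) v :=
      ⟨by rw [List.length_take]; omega, (List.take_prefix _ _).isInfix⟩
    rw [← hfac] at this
    have h₁ := this.2.length_le
    rw [this.1] at h₁
    omega
  rcases Nat.lt_or_ge j u.length with hju | hju
  swap
  · have hjv := short u v hfac hju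
    unfold prefixOf at hpre
    rw [List.take_of_length_le hju, List.take_of_length_le hjv] at hpre
    rwa [← hpre]
  have hjv : j < v.length := by
    by_contra! hv
    have := short v u hfac.symm hv
    omega
  obtain ⟨qu, hqu, hacc⟩ := hu
  -- As the transition function is partial, it must first be shown that v can be read at all. The
  -- first j letters are shared with u. Every later letter, with the j letters before it, is a
  -- factor of u, and the run of u passes through the same state there.
  have defd : ∀ i, j + i ≤ v.length → ∃ q, A.run A.start (v.take (j + i)) = some q := by
    intro i
    induction i with
    | zero =>
      intro _
      have e : v.take j = u.take j := hpre.symm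
      rw [Nat.add_zero, e]
      rw [← List.take_append_drop j u, run_append] at hqu
      obtain ⟨q, hq, -⟩ := Option.bind_eq_some_iff.1 hqu
      exact ⟨q, hq⟩
    | succ i ih =>
      intro hi
      obtain ⟨q, hq⟩ := ih (by omega)
      have hi' : j + i < v.length := by omega
      rw [← Nat.add_assoc, List.take_succ_eq_append_getElem hi', run_append_of_eq_some hq]
      set y := (v.take (j + i)).drop i with hy
      have hylen : y.length = j := by
        rw [hy, List.length_drop, List.length_take]; omega
      have hsplit : v.take (j + i) = (v.take (j + i)).take i ++ y :=
        (List.take_append_drop _ _).symm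
      have hmem : y ++ [v[j + i]] ∈ factorsOf (j + 1) v := by
        refine ⟨by simp [hylen], ?_⟩
        refine List.IsInfix.trans (List.suffix_append ((v.take (j + i)).take i) _).isInfix ?_
        rw [← List.append_assoc, ← hsplit, ← List.take_succ_eq_append_getElem hi']
        exact (List.take_prefix _ _).isInfix
      rw [← hfac] at hmem
      obtain ⟨-, s, t, hst⟩ := hmem
      rw [← hst, run_append, run_append] at hqu
      obtain ⟨q₁, h₁, -⟩ := Option.bind_eq_some_iff.1 hqu
      obtain ⟨q₂, h₂, h₃⟩ := Option.bind_eq_some_iff.1 h₁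
      rw [run_append] at h₃
      obtain ⟨q₃, h₄, h₅⟩ := Option.bind_eq_some_iff.1 h₃
      rw [hsplit, run_append] at hq
      obtain ⟨q₄, -, h₆⟩ := Option.bind_eq_some_iff.1 hq
      rw [uniq y q₄ q₂ q q₃ hylen h₆ h₄]
      exact ⟨_, h₅⟩
  obtain ⟨qv, hqv⟩ := defd (v.length - j) (by omega)
  rw [Nat.add_sub_cancel' hjv.le, List.take_length] at hqv
  refine ⟨qv, hqv, ?_⟩
  -- Both final states are reached by the common suffix of length j, hence they coincide.
  have hlast : ∀ (u : List (Fin A.m)) (q : Fin A.n), A.run A.start u = some q →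
      ∃ p, A.run p (suffixOf j u) = some q := by
    intro u q hq
    rw [← List.take_append_drop (u.length - j) u, run_append] at hq
    obtain ⟨p, -, hp⟩ := Option.bind_eq_some_iff.1 hq
    exact ⟨p, hp⟩
  obtain ⟨pu, hpu⟩ := hlast u qu hqu
  obtain ⟨pv, hpv⟩ := hlast v qv hqv
  rw [hsuf] at hpu
  rw [uniq _ _ _ _ _ (by unfold suffixOf; rw [List.length_drop]; omega) hpv hpu]
  exact hacc

theorem isKTestable_succ_iff (hR : A.IsReduced) (hS : A.IsStronglyConnected) (j : ℕ) :
    IsKTestable (j + 1) A.language ↔ ¬ A.HasSplit j :=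
  ⟨fun h h' => not_isKTestable_of_hasSplit hR hS h' h, isKTestable_of_not_hasSplit⟩

end FinAutomaton

/-- If a decreasing sequence of sets obtained by iterating a monotone function has a nonempty set at
the index given by the number of elements, then all its sets are nonempty. -/
theorem nonempty_of_nonempty_card {X : Type*} [Fintype X] (E : ℕ → Set X) (F : Set X → Set X)
    (hF : Monotone F) (hE : ∀ j, E (j + 1) = F (E j)) (h₀ : E 1 ⊆ E 0)
    (h : (E (Fintype.card X)).Nonempty) (j : ℕ) : (E j).Nonempty := by
  have step : ∀ i, E (i + 1) ⊆ E i := by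
    intro i
    induction i with
    | zero => exact h₀
    | succ i ih => rw [hE (i + 1), hE i]; exact hF (by rwa [← hE])
  have anti : Antitone E := antitone_nat_of_succ_le step
  -- Until two consecutive sets agree, each step loses at least one element.
  have claim : ∀ i, (∃ l < i, E (l + 1) = E l) ∨ (E i).ncard + i ≤ Fintype.card X := by
    intro i
    induction i with
    | zero => exact Or.inr (by rw [← Nat.card_eq_fintype_card]; exact Set.ncard_le_card _)
    | succ i ih =>
      rcases ih with ⟨l, hl, e⟩ | ih
      · exact Or.inl ⟨l, by omega, e⟩
      · by_cases e : E (i + 1) = E i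
        · exact Or.inl ⟨i, by omega, e⟩
        · have := Set.ncard_lt_ncard (LE.le.ssubset_of_ne (step i) e) (Set.toFinite _)
          exact Or.inr (by omega)
  rcases claim (Fintype.card X) with ⟨l, hl, e⟩ | hc
  · have const : ∀ i, E (l + i) = E l := by
      intro i
      induction i with
      | zero => rfl
      | succ i ih => rw [← Nat.add_assoc, hE, ih, ← hE, e]
    have hl' : (E l).Nonempty := h.mono (anti hl.le)
    rw [← const j] at hl'
    exact hl'.mono (anti (by omega))
  · have : (E (Fintype.card X)).ncard = 0 := by omega
    rw [Set.ncard_eq_zero (Set.toFinite _)] at this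
    exact absurd this h.ne_empty

open Classical in
theorem count_eq_of_antitone {R : ℕ → Prop} (hR : ∀ j, R (j + 1) → R j) {j₀ J : ℕ}
    (h₁ : ∀ i < j₀, R i) (h₂ : ¬ R j₀) (hJ : j₀ ≤ J) : Nat.count R J = j₀ := by
  have h₃ : ∀ i, ¬ R (j₀ + i) := by
    intro i
    induction i with
    | zero => exact h₂
    | succ i ih => exact fun h => ih (hR _ h)
  obtain ⟨i, rfl⟩ := Nat.exists_eq_add_of_le hJ
  rw [Nat.count_add, (Nat.count_iff_forall).2 (fun {n} h => h₁ n h),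
    (Nat.count_iff_forall_not).2 (fun {n} _ => h₃ n), Nat.add_zero]

/-! ### Split pairs and the formula for the order -/

namespace FinAutomaton

variable {A : FinAutomaton}

variable (A) in
/-- The pairs of states that are led to different states by some word of length `j`. -/
def splitPairs (j : ℕ) : Set (Fin A.n × Fin A.n) :=
  {x | ∃ w : List (Fin A.m), w.length = j ∧ ∃ p' q', A.run x.1 w = some p' ∧
    A.run x.2 w = some q' ∧ p' ≠ q'}

theorem hasSplit_iff_nonempty (j : ℕ) : A.HasSplit j ↔ (A.splitPairs j).Nonempty := by
  constructor
  · rintro ⟨w, hw, p, q, p', q', h⟩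
    exact ⟨(p, q), w, hw, p', q', h⟩
  · rintro ⟨⟨p, q⟩, w, hw, p', q', h⟩
    exact ⟨w, hw, p, q, p', q', h⟩

theorem mem_splitPairs_zero {p q : Fin A.n} : (p, q) ∈ A.splitPairs 0 ↔ p ≠ q := by
  simp [splitPairs]

theorem mem_splitPairs_succ {p q : Fin A.n} {j : ℕ} : (p, q) ∈ A.splitPairs (j + 1) ↔
    ∃ a p₁ q₁, A.step p a = some p₁ ∧ A.step q a = some q₁ ∧ (p₁, q₁) ∈ A.splitPairs j := by
  constructor
  · rintro ⟨w, hw, p', q', hp, hq, hne⟩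
    cases w with
    | nil => simp at hw
    | cons a w =>
      rw [run_cons] at hp hq
      obtain ⟨p₁, hp₁, hp⟩ := Option.bind_eq_some_iff.1 hp
      obtain ⟨q₁, hq₁, hq⟩ := Option.bind_eq_some_iff.1 hq
      exact ⟨a, p₁, q₁, hp₁, hq₁, w, by simpa using hw, p', q', hp, hq, hne⟩
  · rintro ⟨a, p₁, q₁, hp₁, hq₁, w, hw, p', q', hp, hq, hne⟩
    refine ⟨a :: w, by simp [hw], p', q', ?_, ?_, hne⟩
    · simpa [run_cons, hp₁] using hp
    · simpa [run_cons, hq₁] using hq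

theorem hasSplit_of_succ {j : ℕ} (h : A.HasSplit (j + 1)) : A.HasSplit j := by
  rw [hasSplit_iff_nonempty] at h ⊢
  obtain ⟨⟨p, q⟩, h⟩ := h
  obtain ⟨a, p₁, q₁, -, -, h⟩ := mem_splitPairs_succ.1 h
  exact ⟨_, h⟩

theorem hasSplit_of_le {i j : ℕ} (h : i ≤ j) (hj : A.HasSplit j) : A.HasSplit i := by
  induction h with
  | refl => exact hj
  | step _ ih => exact ih (hasSplit_of_succ hj)

theorem hasSplit_of_sq {j : ℕ} (h : A.HasSplit (A.n * A.n)) : A.HasSplit j := by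
  rw [hasSplit_iff_nonempty] at h ⊢
  refine nonempty_of_nonempty_card A.splitPairs
    (fun E => {x | ∃ a p₁ q₁, A.step x.1 a = some p₁ ∧ A.step x.2 a = some q₁ ∧ (p₁, q₁) ∈ E})
    ?_ (fun j => ?_) ?_ (by simpa using h) j
  · rintro E E' hE x ⟨a, p₁, q₁, h₁, h₂, h₃⟩
    exact ⟨a, p₁, q₁, h₁, h₂, hE h₃⟩
  · ext ⟨p, q⟩
    exact mem_splitPairs_succ
  · rintro ⟨p, q⟩ hpq
    obtain ⟨a, p₁, q₁, h₁, h₂, h₃⟩ := mem_splitPairs_succ.1 hpq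
    rw [mem_splitPairs_zero] at h₃ ⊢
    rintro rfl
    exact h₃ (Option.some.inj (h₁.symm.trans h₂))

open Classical in
-- Splitting is inherited by shorter lengths. The least non-splitting length is therefore the number
-- of splitting ones, and the order is one more.
theorem order_eq (hR : A.IsReduced) (hS : A.IsStronglyConnected) {J : ℕ} (hJ : A.n * A.n ≤ J) :
    A.order = if A.HasSplit J then none else some (Nat.count A.HasSplit (J + 1) + 1) := by
  unfold order
  have iff : ∀ k, 1 ≤ k ∧ IsKTestable k A.language ↔ ∃ j, k = j + 1 ∧ ¬ A.HasSplit j := by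
    intro k
    constructor
    · rintro ⟨hk, h⟩
      obtain ⟨j, rfl⟩ := Nat.exists_eq_add_of_le' hk
      exact ⟨j, rfl, (isKTestable_succ_iff hR hS j).1 h⟩
    · rintro ⟨j, rfl, h⟩
      exact ⟨by omega, (isKTestable_succ_iff hR hS j).2 h⟩
  by_cases h : A.HasSplit J
  · rw [if_pos h, dif_neg]
    rintro ⟨k, hk⟩
    obtain ⟨j, -, hj⟩ := (iff k).1 hk
    exact hj (hasSplit_of_sq (hasSplit_of_le hJ h))
  · have hex : ∃ j, ¬ A.HasSplit j := ⟨J, h⟩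
    have hcount := count_eq_of_antitone (R := A.HasSplit) (J := J + 1)
      (fun j => hasSplit_of_succ) (fun i hi => not_not.1 (Nat.find_min hex hi))
      (Nat.find_spec hex) ((Nat.find_min' hex h).trans (by omega))
    have hk : ∃ k, 1 ≤ k ∧ IsKTestable k A.language := ⟨J + 1, (iff _).2 ⟨J, rfl, h⟩⟩
    rw [if_neg h, dif_pos hk, hcount, Option.some.injEq, Nat.find_eq_iff]
    refine ⟨(iff _).2 ⟨_, rfl, Nat.find_spec hex⟩, fun k hlt hk => ?_⟩
    obtain ⟨j, rfl, hj⟩ := (iff k).1 hk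
    exact Nat.find_min hex (m := j) (by omega) hj

end FinAutomaton

/-! ### Frame rules, invariants and counted loops for commands -/

namespace LoopCommand

open Function

variable {R A : Type}

section Store

variable [DecidableEq R]

@[simp] theorem Store.setReg_reg_self (s : Store R A) (r : R) (v : ℕ) :
    (s.setReg r v).reg r = v := by simp [Store.setReg]

@[simp] theorem Store.setReg_reg_of_ne (s : Store R A) {r r' : R} (h : r' ≠ r) (v : ℕ) :
    (s.setReg r v).reg r' = s.reg r' := by simp [Store.setReg, h]

@[simp] theorem Store.setReg_arr (s : Store R A) (r : R) (v : ℕ) :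
    (s.setReg r v).arr = s.arr := rfl

@[simp] theorem Store.setReg_setReg (s : Store R A) (r : R) (v v' : ℕ) :
    (s.setReg r v).setReg r v' = s.setReg r v' := by simp [Store.setReg]

theorem Store.setReg_comm (s : Store R A) {r r' : R} (h : r ≠ r') (v v' : ℕ) :
    (s.setReg r v).setReg r' v' = (s.setReg r' v').setReg r v := by
  simp [Store.setReg, update_comm h]

theorem Store.setReg_eq_self (s : Store R A) (r : R) {v : ℕ} (h : s.reg r = v) :
    s.setReg r v = s := by
  subst h; simp [Store.setReg]

end Store

section Store

variable [DecidableEq A]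

@[simp] theorem Store.setArr_reg (s : Store R A) (a : A) (i v : ℕ) :
    (s.setArr a i v).reg = s.reg := rfl

@[simp] theorem Store.setArr_arr_self (s : Store R A) (a : A) (i v : ℕ) :
    (s.setArr a i v).arr a = update (s.arr a) i v := by simp [Store.setArr]

@[simp] theorem Store.setArr_arr_of_ne (s : Store R A) {a a' : A} (h : a' ≠ a) (i v : ℕ) :
    (s.setArr a i v).arr a' = s.arr a' := by simp [Store.setArr, h]

end Store

variable [DecidableEq R] [DecidableEq A] {N : ℕ}

/-- The registers that a command may change. -/
def modReg : LoopCommand R A → List R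
  | .skip => []
  | .zero r => [r]
  | .inc r => [r]
  | .dec r => [r]
  | .copy x _ => [x]
  | .read x _ y => [x, y]
  | .write _ y x => [y, x]
  | .ifZero _ P Q => P.modReg ++ Q.modReg
  | .seq P Q => P.modReg ++ Q.modReg
  | .loop P => P.modReg

/-- The arrays that a command may change. -/
def modArr : LoopCommand R A → List A
  | .write a _ _ => [a]
  | .ifZero _ P Q => P.modArr ++ Q.modArr
  | .seq P Q => P.modArr ++ Q.modArr
  | .loop P => P.modArr
  | _ => []

theorem eval_reg_of_notMem (P : LoopCommand R A) {r : R} (h : r ∉ P.modReg) (s : Store R A) :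
    (eval N P s).reg r = s.reg r := by
  induction P generalizing s with
  | ifZero r' P Q ihP ihQ =>
    simp only [modReg, List.mem_append, not_or] at h
    simp only [eval]
    split_ifs
    · exact ihP h.1 s
    · exact ihQ h.2 s
  | seq P Q ihP ihQ =>
    simp only [modReg, List.mem_append, not_or] at h
    rw [eval, ihQ h.2, ihP h.1]
  | loop P ih =>
    have : ∀ i, ((eval N P)^[i] s).reg r = s.reg r := by
      intro i
      induction i with
      | zero => rfl
      | succ i ih' => rw [iterate_succ_apply', ih h, ih']
    exact this N
  | _ => simp_all [modReg, eval]

theorem eval_arr_of_notMem (P : LoopCommand R A) {a : A} (h : a ∉ P.modArr) (s : Store R A) :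
    (eval N P s).arr a = s.arr a := by
  induction P generalizing s with
  | ifZero r' P Q ihP ihQ =>
    simp only [modArr, List.mem_append, not_or] at h
    simp only [eval]
    split_ifs
    · exact ihP h.1 s
    · exact ihQ h.2 s
  | seq P Q ihP ihQ =>
    simp only [modArr, List.mem_append, not_or] at h
    rw [eval, ihQ h.2, ihP h.1]
  | loop P ih =>
    have : ∀ i, ((eval N P)^[i] s).arr a = s.arr a := by
      intro i
      induction i with
      | zero => rfl
      | succ i ih' => rw [iterate_succ_apply', ih h, ih']
    exact this N
  | _ => simp_all [modArr, eval]

/-- The step may assume that whatever the body never modifies still has its initial value, so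
invariants need to mention only what changes. -/
theorem eval_loop_induction {P : LoopCommand R A} {s : Store R A} (Inv : ℕ → Store R A → Prop)
    (h₀ : Inv 0 s)
    (hstep : ∀ i s', i < N → Inv i s' → (∀ r ∉ P.modReg, s'.reg r = s.reg r) →
      (∀ a ∉ P.modArr, s'.arr a = s.arr a) → Inv (i + 1) (eval N P s')) :
    Inv N (eval N (.loop P) s) := by
  have : ∀ i, i ≤ N → Inv i ((eval N P)^[i] s) ∧
      (∀ r ∉ P.modReg, ((eval N P)^[i] s).reg r = s.reg r) ∧
      (∀ a ∉ P.modArr, ((eval N P)^[i] s).arr a = s.arr a) := by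
    intro i
    induction i with
    | zero => exact fun _ => ⟨h₀, fun _ _ => rfl, fun _ _ => rfl⟩
    | succ i ih =>
      intro hi
      obtain ⟨h₁, h₂, h₃⟩ := ih (by omega)
      rw [iterate_succ_apply']
      refine ⟨hstep i _ (by omega) h₁ h₂ h₃, fun r hr => ?_, fun a ha => ?_⟩
      · rw [eval_reg_of_notMem P hr, h₂ r hr]
      · rw [eval_arr_of_notMem P ha, h₃ a ha]
  exact (this N le_rfl).1

/-- Run `P` as many times as register `b` says, counting down in register `t`. -/
def times (t b : R) (P : LoopCommand R A) : LoopCommand R A :=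
  .seq (.copy t b) (.loop (.ifZero t .skip (.seq (.dec t) P)))

theorem eval_copy (s : Store R A) {x y : R} (h : y ≠ x) :
    eval N (.copy x y) s = s.setReg x (s.reg y) := by
  simp [eval, h]

theorem eval_times_induction {P : LoopCommand R A} {s : Store R A} {t b : R}
    (Inv : ℕ → Store R A → Prop) (hb : b ≠ t) (ht : t ∉ P.modReg) (hN : s.reg b ≤ N)
    (h₀ : Inv 0 (s.setReg t (s.reg b)))
    (hstep : ∀ i s', i < s.reg b → Inv i s' → s'.reg t = s.reg b - i →
      (∀ r, r ≠ t → r ∉ P.modReg → s'.reg r = s.reg r) →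
      (∀ a ∉ P.modArr, s'.arr a = s.arr a) →
      Inv (i + 1) (eval N P (s'.setReg t (s.reg b - (i + 1))))) :
    Inv (s.reg b) (eval N (times t b P) s) ∧ (eval N (times t b P) s).reg t = 0 := by
  rw [times, eval, eval_copy _ hb]
  have key := eval_loop_induction (N := N) (P := .ifZero t .skip (.seq (.dec t) P))
    (s := s.setReg t (s.reg b))
    -- The underlying loop always runs `N` times; after the counter reaches zero the rounds are
    -- idle, whence the minimum.
    (fun i s' => Inv (min i (s.reg b)) s' ∧ s'.reg t = s.reg b - min i (s.reg b))
    (by simpa using h₀) (fun i s' hi h hr ha => by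
      obtain ⟨h₁, h₂⟩ := h
      simp only [eval]
      split_ifs with h₀
      · have e₁ : min i (s.reg b) = s.reg b := by omega
        have e₂ : min (i + 1) (s.reg b) = s.reg b := by omega
        rw [e₁] at h₁
        rw [e₂]
        exact ⟨h₁, by omega⟩
      · have e₁ : min i (s.reg b) = i := by omega
        have e₂ : min (i + 1) (s.reg b) = i + 1 := by omega
        rw [e₁] at h₁ h₂
        rw [e₂]
        have e₃ : s'.reg t - 1 = s.reg b - (i + 1) := by omega
        rw [e₃]
        refine ⟨hstep i s' (by omega) h₁ h₂ (fun r hrt hr' => ?_) (fun a ha' => ?_), ?_⟩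
        · rw [hr r (by simp [modReg, hrt, hr']), Store.setReg_reg_of_ne _ hrt]
        · rw [ha a (by simpa [modArr] using ha'), Store.setReg_arr]
        · rw [eval_reg_of_notMem P ht, Store.setReg_reg_self])
  simp only [min_eq_right hN] at key
  exact ⟨key.1, by omega⟩

/-- Run `P` with register `x` counting from `0` to the value of register `b`. -/
def forTo (x t b : R) (P : LoopCommand R A) : LoopCommand R A :=
  .seq (.zero x) (times t b (.seq P (.inc x)))

theorem eval_forTo_induction {P : LoopCommand R A} {s : Store R A} {x t b : R}
    (Inv : ℕ → Store R A → Prop) (hbt : b ≠ t) (hbx : b ≠ x) (hxt : x ≠ t) (ht : t ∉ P.modReg)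
    (hx : x ∉ P.modReg) (hN : s.reg b ≤ N)
    (h₀ : Inv 0 ((s.setReg x 0).setReg t (s.reg b)))
    (hstep : ∀ i s', i < s.reg b → Inv i s' → s'.reg x = i →
      (∀ r, r ≠ t → r ≠ x → r ∉ P.modReg → s'.reg r = s.reg r) →
      (∀ a ∉ P.modArr, s'.arr a = s.arr a) →
      Inv (i + 1) ((eval N P (s'.setReg t (s.reg b - (i + 1)))).setReg x (i + 1))) :
    Inv (s.reg b) (eval N (forTo x t b P) s) := by
  rw [forTo, eval, eval]
  have hb' : (s.setReg x 0).reg b = s.reg b := Store.setReg_reg_of_ne _ hbx _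
  have key := eval_times_induction (N := N) (P := .seq P (.inc x)) (s := s.setReg x 0) (t := t)
    (b := b) (fun i s' => Inv i s' ∧ s'.reg x = i) hbt (by simp [modReg, ht, hxt.symm])
    (by rwa [hb']) ⟨by rwa [hb'], by simp [hxt]⟩ (fun i s' hi h ht' hr ha => by
      rw [hb'] at hi ⊢
      have e := hstep i s' hi h.1 h.2 (fun r h₁ h₂ h₃ => by
        rw [hr r h₁ (by simp [modReg, h₂, h₃]), Store.setReg_reg_of_ne _ h₂])
        (fun a ha' => by rw [ha a (by simpa [modArr] using ha'), Store.setReg_arr])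
      have ex : (eval N P (s'.setReg t (s.reg b - (i + 1)))).reg x = i := by
        rw [eval_reg_of_notMem P hx, Store.setReg_reg_of_ne _ hxt, h.2]
      rw [eval, eval, ex]
      exact ⟨e, by simp⟩)
  rw [hb'] at key
  exact key.1.1

/-- Add register `z` to register `d`, using the counter `t`. -/
def addTo (d z t : R) : LoopCommand R A := times t z (.inc d)

theorem eval_addTo {s : Store R A} {d z t : R} (hzt : z ≠ t) (hdt : d ≠ t) (hN : s.reg z ≤ N) :
    eval N (addTo d z t) s = (s.setReg t 0).setReg d (s.reg d + s.reg z) := by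
  have key := eval_times_induction (N := N) (P := .inc d) (s := s)
    (fun i s' => s' = (s.setReg t (s.reg z - i)).setReg d (s.reg d + i)) hzt
    (by simp [modReg, hdt.symm]) hN
    (by rw [Nat.sub_zero, Nat.add_zero, Store.setReg_eq_self _ d]; simp [hdt])
    (by
      rintro i s' hi rfl - - -
      simp only [eval]
      rw [Store.setReg_comm _ hdt, Store.setReg_setReg, Store.setReg_setReg,
        Store.setReg_reg_self, Nat.add_assoc])
  rw [addTo, key.1, Nat.sub_self]

/-- Add the product of the registers `x` and `y` to register `d`, using the counters `t` and
`t'`. -/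
def mulTo (d x y t t' : R) : LoopCommand R A := .seq (.zero t') (times t x (addTo d y t'))

theorem eval_mulTo {s : Store R A} {d x y t t' : R} (hxt : x ≠ t) (hxt' : x ≠ t') (htt' : t ≠ t')
    (hdt : d ≠ t) (hdt' : d ≠ t') (hyt : y ≠ t) (hyt' : y ≠ t') (hyd : y ≠ d)
    (hx : s.reg x ≤ N) (hy : s.reg y ≤ N) :
    eval N (mulTo d x y t t') s =
      ((s.setReg t' 0).setReg t 0).setReg d (s.reg d + s.reg x * s.reg y) := by
  have key := eval_times_induction (N := N) (P := addTo d y t') (s := s.setReg t' 0)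
    (fun i s' => s' = ((s.setReg t' 0).setReg t (s.reg x - i)).setReg d (s.reg d + i * s.reg y)) hxt
    (by simp [modReg, addTo, times, hdt.symm, htt']) (by simpa [hxt'] using hx)
    (by rw [Nat.sub_zero, Nat.zero_mul, Nat.add_zero, Store.setReg_eq_self _ d] <;>
      simp [hdt, hdt', hxt'])
    (by
      rintro i s' hi rfl - - -
      rw [Store.setReg_reg_of_ne _ hxt', Store.setReg_comm _ hdt, Store.setReg_setReg,
        eval_addTo hyt' hdt' (by simpa [hyd, hyt, hyt'] using hy)]
      rw [Store.setReg_comm _ hdt', Store.setReg_setReg, Store.setReg_comm _ htt',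
        Store.setReg_setReg]
      simp [hyd, hyt, hyt', Nat.add_mul, Nat.add_assoc])
  rw [Store.setReg_reg_of_ne _ hxt', Nat.sub_self] at key
  rw [mulTo, eval, eval, key.1]

end LoopCommand

/-! ### The program that computes the order of local testability -/

namespace OrderProgram

open LoopCommand
open StackProgram (encodeList encodeList_nil encodeList_cons)
open Function (update update_apply)

/-- The registers of the program. -/
inductive Reg : Type
  | n | m | n₁ | c | f | e | d | base | x | y | a | p | q | u | v | w | g | k | out
  | t₁ | t₂ | t₃ | t₄ | t₅
  deriving DecidableEq

instance : Fintype Reg where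
  elems := {.n, .m, .n₁, .c, .f, .e, .d, .base, .x, .y, .a, .p, .q, .u, .v, .w, .g, .k, .out,
    .t₁, .t₂, .t₃, .t₄, .t₅}
  complete r := by cases r <;> decide

/-- The arrays of the program: input bits, transition table, and the table of split pairs. -/
inductive Arr : Type
  | inp | tab | bit
  deriving DecidableEq

instance : Fintype Arr where
  elems := {.inp, .tab, .bit}
  complete a := by cases a <;> decide

/-- Run a list of commands one after the other. -/
def block (l : List (LoopCommand Reg Arr)) : LoopCommand Reg Arr := l.foldr .seq .skip

@[simp] theorem eval_block_nil {N : ℕ} (s : Store Reg Arr) : eval N (block []) s = s := rfl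

@[simp] theorem eval_block_cons {N : ℕ} (P l) (s : Store Reg Arr) :
    eval N (block (P :: l)) s = eval N (block l) (eval N P s) := rfl

/-- Read a number in self-delimiting unary at the position `c` of the input. -/
def readUnary (r : Reg) : LoopCommand Reg Arr :=
  block [.zero r, .zero .f, .inc .f, .loop (.ifZero .f .skip
    (block [.copy .u .c, .read .v .inp .u, .inc .c, .ifZero .v (.zero .f) (.inc r)]))]

/-- Read one entry of the transition table. -/
def readEntry : LoopCommand Reg Arr :=
  block [readUnary .w, .copy .u .e, .write .tab .u .w, .inc .e]

/-- Read the input. -/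
def readInput : LoopCommand Reg Arr :=
  block [.zero .c, readUnary .n, readUnary .m, readUnary .w, addTo .c .n .t₁, .copy .n₁ .n,
    .inc .n₁, .copy .e .m, .loop readEntry]

variable {N : ℕ} {s : Store Reg Arr}

/-- The flag `f` stays one until the delimiter is met. Reading `k` ones and the delimiter takes `k +
1` rounds, so `k < N` is needed; further rounds do nothing. -/
theorem eval_readUnary {r : Reg} (hr : r ∉ [Reg.f, .u, .v, .c]) {k : ℕ} (hk : k < N)
    (h₁ : ∀ i < k, s.arr .inp (s.reg .c + i) ≠ 0) (h₀ : s.arr .inp (s.reg .c + k) = 0) :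
    (eval N (readUnary r) s).reg r = k ∧
      (eval N (readUnary r) s).reg .c = s.reg .c + k + 1 := by
  simp only [List.mem_cons, List.not_mem_nil, or_false, not_or] at hr
  obtain ⟨hf, hu, hv, hc⟩ := hr
  simp only [readUnary, eval_block_cons, eval_block_nil]
  have key := eval_loop_induction (N := N) (P := .ifZero .f .skip
    (block [.copy .u .c, .read .v .inp .u, .inc .c, .ifZero .v (.zero .f) (.inc r)]))
    (s := eval N (.inc .f) (eval N (.zero .f) (eval N (.zero r) s)))
    (fun i s' => if i ≤ k then s'.reg r = i ∧ s'.reg .c = s.reg .c + i ∧ s'.reg .f = 1 else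
      s'.reg r = k ∧ s'.reg .c = s.reg .c + k + 1 ∧ s'.reg .f = 0)
    (by simp [eval, hf, Ne.symm hc]) (fun i s' hi h _ ha => by
      have ha' : s'.arr .inp = s.arr .inp := by
        rw [ha _ (by simp [modArr, block])]; rfl
      by_cases hik : i ≤ k
      · rw [if_pos hik] at h
        obtain ⟨e₁, e₂, e₃⟩ := h
        have er : (eval N (.copy .u .c) s').reg .u = s.reg .c + i := by simp [eval, e₂]
        rcases hik.lt_or_eq with hik | rfl
        · have e₄ := h₁ i hik
          rw [if_pos (by omega)]
          simp [eval, e₃, e₂, ha', e₄, e₁, hu, hv, hc, Ne.symm hc, Ne.symm hf, Nat.add_assoc]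
        · rw [if_neg (by omega)]
          simp [eval, e₃, e₂, ha', h₀, e₁, hf, hu, hv, hc, Nat.add_assoc]
      · rw [if_neg hik] at h
        rw [if_neg (by omega)]
        simpa [eval, h.2.2] using h)
  rw [if_neg (by omega)] at key
  exact ⟨key.1, key.2.1⟩

theorem getD_map_toNat_add (W : List Bool) (c i : ℕ) :
    (W.map Bool.toNat).getD (c + i) 0 = ((W.drop c).map Bool.toNat).getD i 0 := by
  simp [List.getD_eq_getElem?_getD]

theorem getD_encodeUnary_of_lt {k i : ℕ} (h : i < k) (rest : List Bool) :
    ((encodeUnary k ++ rest).map Bool.toNat).getD i 0 ≠ 0 := by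
  simp [encodeUnary, List.getD_eq_getElem?_getD, List.getElem?_append, h]

theorem getD_encodeUnary_self (k : ℕ) (rest : List Bool) :
    ((encodeUnary k ++ rest).map Bool.toNat).getD k 0 = 0 := by
  simp [encodeUnary, List.getD_eq_getElem?_getD]

theorem eval_readUnary_of_drop {r : Reg} (hr : r ∉ [Reg.f, .u, .v, .c]) {W rest : List Bool}
    {k : ℕ} (hN : W.length = N) (hW : ∀ i, s.arr .inp i = (W.map Bool.toNat).getD i 0)
    (h : W.drop (s.reg .c) = encodeUnary k ++ rest) :
    (eval N (readUnary r) s).reg r = k ∧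
      W.drop ((eval N (readUnary r) s).reg .c) = rest := by
  have hlen := congrArg List.length h
  simp only [encodeUnary, List.length_drop, List.length_append, List.length_replicate,
    List.length_singleton] at hlen
  obtain ⟨h₁, h₂⟩ := eval_readUnary (N := N) (s := s) hr (k := k) (by omega)
    (fun i hi => by rw [hW, getD_map_toNat_add, h]; exact getD_encodeUnary_of_lt hi rest)
    (by rw [hW, getD_map_toNat_add, h]; exact getD_encodeUnary_self k rest)
  refine ⟨h₁, ?_⟩
  rw [h₂, Nat.add_assoc, ← List.drop_drop, h]
  have : k + 1 = (encodeUnary k).length := by simp [encodeUnary]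
  rw [this, List.drop_left]

theorem eval_readUnary_frame {r r' : Reg} (h : r' ∉ [Reg.f, .u, .v, .c]) (hr : r' ≠ r) :
    (eval N (readUnary r) s).reg r' = s.reg r' := by
  refine eval_reg_of_notMem _ ?_ s
  simp [modReg, readUnary, block, hr] at h ⊢
  tauto

theorem eval_readUnary_arr {r : Reg} : (eval N (readUnary r) s).arr = s.arr := by
  funext a
  exact eval_arr_of_notMem _ (by simp [modArr, readUnary, block]) s

/-- The initial state is read into a scratch register and the acceptance flags are skipped. Writing
the table starts at position `m`, which leaves a row of zeros for the code zero of a missing state.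
-/
theorem eval_readInput {W acc : List Bool} {n m st : ℕ} {vals : List ℕ}
    (hW : W = encodeUnary n ++ (encodeUnary m ++ (encodeUnary st ++ (acc ++ encodeList vals))))
    (hacc : acc.length = n) (hvals : vals.length ≤ W.length)
    (hs : s = inputStore .inp W) :
    (eval W.length readInput s).reg .n = n ∧ (eval W.length readInput s).reg .m = m ∧
    (eval W.length readInput s).reg .n₁ = n + 1 ∧
    (eval W.length readInput s).arr .tab =
      (fun j => if m ≤ j then vals.getD (j - m) 0 else 0) ∧
    (eval W.length readInput s).arr .bit = fun _ => 0 := by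
  set N := W.length with hN
  have hinp : ∀ i, s.arr .inp i = (W.map Bool.toNat).getD i 0 := by
    intro i; subst hs; simp [inputStore]
  simp only [readInput, eval_block_cons, eval_block_nil]
  set s₁ := eval N (.zero .c) s with hs₁
  have c₁ : s₁.reg .c = 0 := by simp [hs₁, eval]
  have a₁ : s₁.arr = s.arr := rfl
  obtain ⟨h₂, d₂⟩ := eval_readUnary_of_drop (N := N) (s := s₁) (r := .n) (by simp) hN.symm
    (by rwa [a₁]) (by rw [c₁, List.drop_zero]; exact hW)
  set s₂ := eval N (readUnary .n) s₁ with hs₂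
  have a₂ : s₂.arr = s.arr := by rw [hs₂, eval_readUnary_arr, a₁]
  obtain ⟨h₃, d₃⟩ := eval_readUnary_of_drop (N := N) (s := s₂) (r := .m) (by simp) hN.symm
    (by rwa [a₂]) d₂
  set s₃ := eval N (readUnary .m) s₂ with hs₃
  have a₃ : s₃.arr = s.arr := by rw [hs₃, eval_readUnary_arr, a₂]
  have n₃ : s₃.reg .n = n := by rw [hs₃, eval_readUnary_frame (by simp) (by simp), h₂]
  obtain ⟨h₄, d₄⟩ := eval_readUnary_of_drop (N := N) (s := s₃) (r := .w) (by simp) hN.symm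
    (by rwa [a₃]) d₃
  set s₄ := eval N (readUnary .w) s₃ with hs₄
  have a₄ : s₄.arr = s.arr := by rw [hs₄, eval_readUnary_arr, a₃]
  have n₄ : s₄.reg .n = n := by rw [hs₄, eval_readUnary_frame (by simp) (by simp), n₃]
  have m₄ : s₄.reg .m = m := by rw [hs₄, eval_readUnary_frame (by simp) (by simp), h₃]
  have hnN : n ≤ N := by rw [hN, hW]; simp [encodeUnary]
  rw [eval_addTo (by simp) (by simp) (by rw [n₄]; exact hnN)]
  set s₅ := eval N (.copy .e .m) (eval N (.inc .n₁) (eval N (.copy .n₁ .n)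
    ((s₄.setReg .t₁ 0).setReg .c (s₄.reg .c + s₄.reg .n)))) with hs₅
  have a₅ : s₅.arr = s.arr := by rw [← a₄]; rfl
  have n₅ : s₅.reg .n = n := by simp [hs₅, eval, n₄]
  have m₅ : s₅.reg .m = m := by simp [hs₅, eval, m₄]
  have nn₅ : s₅.reg .n₁ = n + 1 := by simp [hs₅, eval, n₄]
  have e₅ : s₅.reg .e = m := by simp [hs₅, eval, m₄]
  have c₅ : W.drop (s₅.reg .c) = encodeList vals := by
    have : s₅.reg .c = s₄.reg .c + n := by simp [hs₅, eval, n₄]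
    rw [this, ← List.drop_drop, d₄, ← hacc, List.drop_left]
  have key := eval_loop_induction (N := N) (P := readEntry) (s := s₅)
    (fun i s' => s'.reg .e = m + i ∧ W.drop (s'.reg .c) = encodeList (vals.drop i) ∧
      ∀ j, s'.arr .tab j = if m ≤ j ∧ j < m + i then vals.getD (j - m) 0 else 0)
    ⟨by rw [e₅, Nat.add_zero], by rw [c₅, List.drop_zero], fun j => by
      rw [a₅, if_neg (by omega)]; subst hs; simp [inputStore]⟩
    (fun i s' hi h hr ha => by
      obtain ⟨h₁, h₂, h₃⟩ := h
      have hinp' : ∀ i, s'.arr .inp i = (W.map Bool.toNat).getD i 0 := by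
        rw [ha .inp (by simp [readEntry, modArr, block, readUnary]), a₅]; exact hinp
      have hread : (eval N (readUnary .w) s').reg .w = vals.getD i 0 ∧
          W.drop ((eval N (readUnary .w) s').reg .c) = encodeList (vals.drop (i + 1)) := by
        rcases Nat.lt_or_ge i vals.length with hiv | hiv
        · rw [List.drop_eq_getElem_cons hiv] at h₂
          have := eval_readUnary_of_drop (N := N) (s := s') (r := .w) (by simp) hN.symm hinp'
            (k := vals[i]) (rest := encodeList (vals.drop (i + 1)))
            (by rw [h₂, encodeList_cons, encodeUnary, List.append_assoc]; rfl)
          rwa [List.getD_eq_getElem _ _ hiv]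
        -- The loop continues after the last entry. Beyond the input the array is zero, so only
        -- zeros are appended to the table.
        · have hd : vals.drop i = [] := List.drop_eq_nil_of_le hiv
          have hd' : vals.drop (i + 1) = [] := List.drop_eq_nil_of_le (by omega)
          rw [hd, encodeList_nil] at h₂
          obtain ⟨e₁, e₂⟩ := eval_readUnary (N := N) (s := s') (r := .w) (by simp) (k := 0)
            (by omega) (by simp) (by rw [hinp', getD_map_toNat_add, h₂]; rfl)
          rw [e₁, e₂, hd', List.getD_eq_default _ _ hiv]
          refine ⟨rfl, ?_⟩
          rw [Nat.add_zero, ← List.drop_drop, h₂]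
          rfl
      obtain ⟨e₁, e₂⟩ := hread
      have e₃ : (eval N (readUnary .w) s').reg .e = m + i := by
        rw [eval_readUnary_frame (by simp) (by simp), h₁]
      have e₄ : (eval N (readUnary .w) s').arr = s'.arr := eval_readUnary_arr
      simp only [readEntry, eval_block_cons, eval_block_nil]
      set s'' := eval N (readUnary .w) s'
      refine ⟨by simp [eval, e₃, Nat.add_assoc], by simpa [eval] using e₂, fun j => ?_⟩
      simp only [eval, Store.setReg_arr, Store.setArr_arr_self, e₄, update_apply]
      rw [h₃]
      simp only [Store.setReg_reg_self, Store.setReg_reg_of_ne, ne_eq, reduceCtorEq,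
        not_false_eq_true, e₁, e₃]
      split_ifs with h₁ h₂ h₂ h₃ h₃
      · subst h₁; rw [Nat.add_sub_cancel_left]
      · omega
      · rfl
      · omega
      · omega
      · rfl)
  have fr : ∀ r, r ∉ readEntry.modReg → (eval N (.loop readEntry) s₅).reg r = s₅.reg r :=
    fun r hr => eval_reg_of_notMem (.loop readEntry) hr s₅
  have mr : ∀ r ∈ [Reg.n, .m, .n₁], r ∉ readEntry.modReg := by
    simp [readEntry, modReg, block, readUnary]
  refine ⟨?_, ?_, ?_, ?_, ?_⟩
  · rw [fr _ (mr _ (by simp)), n₅]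
  · rw [fr _ (mr _ (by simp)), m₅]
  · rw [fr _ (mr _ (by simp)), nn₅]
  · funext j
    rw [key.2.2 j]
    split_ifs with h₁ h₂ h₂
    · rfl
    · omega
    · rw [List.getD_eq_default _ _ (by omega)]
    · rfl
  · rw [eval_arr_of_notMem _ (by simp [readEntry, modArr, block, readUnary]), a₅]
    subst hs
    rfl

end OrderProgram

/-! ### The tables of split pairs and the commands that compute them -/

namespace OrderProgram

open LoopCommand
open Function (update update_apply)

/-- With states coded by positive numbers and `T (x * m + a)` the code of the state reached from
`x` by the letter `a` (`0` if there is none): some word of length `j` leads from `x` and `y` to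
states in decreasing order. -/
def PairBit (T : ℕ → ℕ) (m : ℕ) : ℕ → ℕ → ℕ → Prop
  | 0, x, y => 0 < y ∧ y < x
  | j + 1, x, y => ∃ a < m, PairBit T m j (T (x * m + a)) (T (y * m + a))

open Classical in
/-- The table of all `PairBit T m j x y` for `x, y < n₁`, in lexicographic order. -/
noncomputable def cellValue (T : ℕ → ℕ) (m n₁ i : ℕ) : ℕ :=
  if PairBit T m (i / (n₁ * n₁)) (i % (n₁ * n₁) / n₁) (i % n₁) then 1 else 0

variable {T : ℕ → ℕ} {m n₁ : ℕ}

theorem cell_lt {x y : ℕ} (hx : x < n₁) (hy : y < n₁) : x * n₁ + y < n₁ * n₁ := by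
  nlinarith [Nat.mul_le_mul_right n₁ (Nat.succ_le_of_lt hx)]

open Classical in
theorem cellValue_cell {j x y : ℕ} (hx : x < n₁) (hy : y < n₁) :
    cellValue T m n₁ (j * (n₁ * n₁) + (x * n₁ + y)) = if PairBit T m j x y then 1 else 0 := by
  have h := cell_lt hx hy
  have h₁ : 0 < n₁ := by omega
  have h₂ : 0 < n₁ * n₁ := Nat.mul_pos h₁ h₁
  have e₁ : (j * (n₁ * n₁) + (x * n₁ + y)) / (n₁ * n₁) = j := by
    rw [Nat.add_comm, Nat.add_mul_div_right _ _ h₂, Nat.div_eq_of_lt h, Nat.zero_add]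
  have e₂ : (j * (n₁ * n₁) + (x * n₁ + y)) % (n₁ * n₁) / n₁ = x := by
    rw [Nat.add_comm, Nat.add_mul_mod_self_right, Nat.mod_eq_of_lt h, Nat.add_comm,
      Nat.add_mul_div_right _ _ h₁, Nat.div_eq_of_lt hy, Nat.zero_add]
  have e₃ : (j * (n₁ * n₁) + (x * n₁ + y)) % n₁ = y := by
    rw [← Nat.add_assoc, ← Nat.mul_assoc, ← Nat.add_mul, Nat.add_comm,
      Nat.add_mul_mod_self_right, Nat.mod_eq_of_lt hy]
  rw [cellValue, e₁, e₂, e₃]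

theorem cellValue_cell_ne_zero {j x y : ℕ} (hx : x < n₁) (hy : y < n₁) :
    cellValue T m n₁ (j * (n₁ * n₁) + (x * n₁ + y)) ≠ 0 ↔ PairBit T m j x y := by
  rw [cellValue_cell hx hy]
  split_ifs with h <;> simp [h]

theorem exists_cellValue_ne_zero {j : ℕ} :
    (∃ i < n₁ * n₁, cellValue T m n₁ (j * (n₁ * n₁) + i) ≠ 0) ↔
      ∃ x < n₁, ∃ y < n₁, PairBit T m j x y := by
  constructor
  · rintro ⟨i, hi, h⟩
    have h₁ : 0 < n₁ := by rcases Nat.eq_zero_or_pos n₁ with rfl | h₁ <;> omega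
    have hx : i / n₁ < n₁ := Nat.div_lt_of_lt_mul hi
    have hy : i % n₁ < n₁ := Nat.mod_lt _ h₁
    refine ⟨_, hx, _, hy, (cellValue_cell_ne_zero hx hy).1 ?_⟩
    rwa [Nat.div_add_mod']
  · rintro ⟨x, hx, y, hy, h⟩
    exact ⟨_, cell_lt hx hy, (cellValue_cell_ne_zero hx hy).2 h⟩

/-- Set a register to one. -/
def setOne (r : Reg) : LoopCommand Reg Arr := block [.zero r, .inc r]

/-- Let `r` be the code of the state reached from `z` by the letter `a`. -/
def fetch (r z : Reg) : LoopCommand Reg Arr :=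
  block [.zero .u, mulTo .u z .m .t₄ .t₅, addTo .u .a .t₄, .read r .tab .u]

/-- Set `w` to one if the states reached from `x` and `y` by the letter `a` form a split pair. -/
def testLetter : LoopCommand Reg Arr :=
  block [fetch .p .x, fetch .q .y, .copy .u .base, mulTo .u .p .n₁ .t₄ .t₅, addTo .u .q .t₄,
    .read .v .bit .u, .ifZero .v .skip (setOne .w)]

/-- Compute an entry of the next table of split pairs; set `g` to one if the corresponding entry
of the current table is not zero. -/
def nextCell : LoopCommand Reg Arr :=
  block [.copy .u .d, .read .v .bit .u, .ifZero .v .skip (setOne .g), .inc .d, .zero .w,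
    forTo .a .t₃ .m testLetter, .copy .u .e, .write .bit .u .w, .inc .e]

/-- Compute the next table of split pairs and count the current one in `k` if it is not empty. -/
def nextTable : LoopCommand Reg Arr :=
  block [.zero .g, .copy .d .base, forTo .x .t₁ .n₁ (forTo .y .t₂ .n₁ nextCell), .copy .base .d,
    .ifZero .g .skip (.inc .k)]

/-- Compute an entry of the first table of split pairs. -/
def firstCell : LoopCommand Reg Arr :=
  block [.zero .w, .ifZero .d .skip (.ifZero .y .skip (.inc .w)), .dec .d, .copy .u .e,
    .write .bit .u .w, .inc .e]

/-- Compute the first table of split pairs. -/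
def firstTable : LoopCommand Reg Arr :=
  block [.zero .e, forTo .x .t₁ .n₁ (block [.copy .d .x, forTo .y .t₂ .n₁ firstCell])]

/-- Compute the order of local testability; the result is incremented, with `0` standing for
automata that are not locally testable. -/
def main : LoopCommand Reg Arr :=
  block [readInput, firstTable, .zero .base, .zero .k, .loop (.loop nextTable),
    .ifZero .g (block [.copy .out .k, .inc .out, .inc .out]) (.zero .out)]

variable {N : ℕ} {s : Store Reg Arr}

theorem eval_fetch {r z : Reg} (hz : z = .x ∨ z = .y) (hzN : s.reg z ≤ N) (hm : s.reg .m ≤ N)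
    (ha : s.reg .a ≤ N) :
    (eval N (fetch r z) s).reg r = s.arr .tab (s.reg z * s.reg .m + s.reg .a) := by
  have h : z ≠ .u ∧ z ≠ .t₄ ∧ z ≠ .t₅ := by rcases hz with rfl | rfl <;> simp
  simp only [fetch, eval_block_cons, eval_block_nil]
  have e : eval N (.zero .u) s = s.setReg .u 0 := rfl
  rw [e, eval_mulTo h.2.1 h.2.2 (by simp) (by simp) (by simp) (by simp) (by simp) (by simp)
    (by simpa [h.1] using hzN) (by simpa using hm), eval_addTo (by simp) (by simp)
    (by simpa using ha)]
  simp [eval, h.1]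

theorem eval_testLetter (hx : s.reg .x ≤ N) (hy : s.reg .y ≤ N) (hm : s.reg .m ≤ N)
    (ha : s.reg .a ≤ N) (hn : s.reg .n₁ ≤ N) (hT : ∀ i, s.arr .tab i ≤ N) :
    (eval N testLetter s).reg .w =
      if s.arr .bit (s.reg .base + (s.arr .tab (s.reg .x * s.reg .m + s.reg .a) * s.reg .n₁ +
        s.arr .tab (s.reg .y * s.reg .m + s.reg .a))) = 0 then s.reg .w else 1 := by
  simp only [testLetter, eval_block_cons, eval_block_nil]
  set s₁ := eval N (fetch .p .x) s with hs₁
  have p₁ : s₁.reg .p = s.arr .tab (s.reg .x * s.reg .m + s.reg .a) :=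
    eval_fetch (Or.inl rfl) hx hm ha
  have fr : ∀ (r z r' : Reg), r' ∉ [r, .u, .t₄, .t₅] → ∀ s : Store Reg Arr,
      (eval N (fetch r z) s).reg r' = s.reg r' := by
    intro r z r' h s
    refine eval_reg_of_notMem _ ?_ s
    simp [fetch, modReg, block, mulTo, addTo, times] at h ⊢
    tauto
  have fa : ∀ (r z : Reg) (s : Store Reg Arr), (eval N (fetch r z) s).arr = s.arr := by
    intro r z s
    funext a
    exact eval_arr_of_notMem _ (by simp [fetch, modArr, block, mulTo, addTo, times]) s
  set s₂ := eval N (fetch .q .y) s₁ with hs₂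
  have q₂ : s₂.reg .q = s.arr .tab (s.reg .y * s.reg .m + s.reg .a) := by
    rw [hs₂, eval_fetch (Or.inr rfl), hs₁, fa, fr _ _ _ (by simp), fr _ _ _ (by simp),
      fr _ _ _ (by simp)]
    all_goals rw [hs₁, fr _ _ _ (by simp)]; assumption
  have p₂ : s₂.reg .p = s.arr .tab (s.reg .x * s.reg .m + s.reg .a) := by
    rw [hs₂, fr _ _ _ (by simp), p₁]
  have fr₂ : ∀ r, r ∉ [Reg.p, .q, .u, .t₄, .t₅] → s₂.reg r = s.reg r := by
    intro r hr
    simp only [List.mem_cons, List.not_mem_nil, or_false, not_or] at hr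
    rw [hs₂, fr _ _ _ (by simp; tauto), hs₁, fr _ _ _ (by simp; tauto)]
  have a₂ : s₂.arr = s.arr := by rw [hs₂, fa, hs₁, fa]
  rw [eval_copy _ (by simp), eval_mulTo (by simp) (by simp) (by simp) (by simp) (by simp) (by simp)
    (by simp) (by simp) (by simpa [p₂] using hT _) (by simpa [fr₂] using hn),
    eval_addTo (by simp) (by simp) (by simpa [q₂] using hT _)]
  simp [eval, setOne, p₂, q₂, fr₂, a₂, Nat.add_assoc]
  split_ifs <;> simp [fr₂]

/-- The entries in a store on which `nextTable` and its parts depend. -/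
structure Context (T : ℕ → ℕ) (m n₁ j : ℕ) (s : Store Reg Arr) : Prop where
  tab_eq : s.arr .tab = T
  m_eq : s.reg .m = m
  n₁_eq : s.reg .n₁ = n₁
  base_eq : s.reg .base = j * (n₁ * n₁)

theorem Context.congr {j : ℕ} (h : Context T m n₁ j s) {s' : Store Reg Arr}
    (h₁ : s'.arr .tab = s.arr .tab) (h₂ : ∀ r ∈ [Reg.m, .n₁, .base], s'.reg r = s.reg r) :
    Context T m n₁ j s' :=
  ⟨by rw [h₁, h.tab_eq], by rw [h₂ _ (by simp), h.m_eq], by rw [h₂ _ (by simp), h.n₁_eq],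
    by rw [h₂ _ (by simp), h.base_eq]⟩

theorem modReg_testLetter :
    testLetter.modReg ⊆ [Reg.p, .q, .u, .v, .w, .t₄, .t₅] := by decide

theorem modArr_testLetter : testLetter.modArr = [] := by decide

end OrderProgram

/-! ### Correctness of the table computation -/

namespace OrderProgram

open LoopCommand
open Function (update update_apply)

variable {T : ℕ → ℕ} {m n₁ N j x y : ℕ} {s : Store Reg Arr}

theorem exists_lt_succ_iff {p : ℕ → Prop} {i : ℕ} :
    (∃ l < i + 1, p l) ↔ (∃ l < i, p l) ∨ p i := by
  simp only [Nat.lt_succ_iff_lt_or_eq, or_and_right, exists_or, exists_eq_left]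

open Classical in
-- All codes in the transition table are below `n₁`, so every lookup falls inside the `j`-th table,
-- which is already complete.
theorem eval_letters (hC : Context T m n₁ j s) (hx : s.reg .x = x) (hy : s.reg .y = y)
    (hxn : x < n₁) (hyn : y < n₁) (hn : n₁ ≤ N) (hm : m ≤ N) (hT : ∀ i, T i < n₁)
    (hbit : ∀ i < (j + 1) * (n₁ * n₁), s.arr .bit i = cellValue T m n₁ i) (hw : s.reg .w = 0) :
    (eval N (forTo .a .t₃ .m testLetter) s).reg .w =
      cellValue T m n₁ ((j + 1) * (n₁ * n₁) + (x * n₁ + y)) := by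
  have key := eval_forTo_induction (N := N) (P := testLetter) (s := s) (x := .a) (t := .t₃)
    (b := .m) (fun i s' => s'.reg .w =
      if ∃ a < i, PairBit T m j (T (x * m + a)) (T (y * m + a)) then 1 else 0)
    (by simp) (by simp) (by simp) (by decide) (by decide) (by rw [hC.m_eq]; exact hm)
    (by simp [hw]) (fun i s' hi h ha hr hra => by
      rw [hC.m_eq] at hi
      have fr : ∀ r, r ∉ [Reg.a, .t₃, .p, .q, .u, .v, .w, .t₄, .t₅] → s'.reg r = s.reg r := by
        intro r h
        simp only [List.mem_cons, List.not_mem_nil, or_false, not_or] at h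
        exact hr r h.2.1 h.1 fun h' => by simpa [h] using modReg_testLetter h'
      have far : s'.arr = s.arr := by
        funext a
        exact hra a (by simp [modArr_testLetter])
      have ex : s'.reg .x = x := by rw [fr _ (by simp), hx]
      have ey : s'.reg .y = y := by rw [fr _ (by simp), hy]
      have em : s'.reg .m = m := by rw [fr _ (by simp), hC.m_eq]
      have en : s'.reg .n₁ = n₁ := by rw [fr _ (by simp), hC.n₁_eq]
      have eb : s'.reg .base = j * (n₁ * n₁) := by rw [fr _ (by simp), hC.base_eq]
      rw [Store.setReg_reg_of_ne _ (by simp), eval_testLetter]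
      · simp only [Store.setReg_arr, Store.setReg_reg_of_ne, ne_eq, reduceCtorEq,
          not_false_eq_true, ex, ey, em, en, eb, ha, far, hC.tab_eq, h]
        have hc := cell_lt (hT (x * m + i)) (hT (y * m + i))
        rw [hbit _ (by rw [Nat.add_mul]; omega), cellValue_cell (hT _) (hT _)]
        by_cases h₁ : PairBit T m j (T (x * m + i)) (T (y * m + i)) <;>
          simp only [exists_lt_succ_iff, h₁, or_true, or_false, if_true, if_false,
            one_ne_zero]
      · simpa [ex] using by omega
      · simpa [ey] using by omega
      · simpa [em] using hm
      · simpa [ha] using by omega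
      · simpa [en] using hn
      · intro i
        simp only [Store.setReg_arr, far, hC.tab_eq]
        exact (hT i).le.trans hn)
  rw [hC.m_eq] at key
  rw [key, cellValue_cell hxn hyn]
  exact if_congr Iff.rfl rfl rfl

/-- `nextTable` has computed `i` entries of the table following the `j`-th one. -/
structure Scan (T : ℕ → ℕ) (m n₁ j i : ℕ) (s : Store Reg Arr) : Prop where
  d_eq : s.reg .d = j * (n₁ * n₁) + i
  e_eq : s.reg .e = (j + 1) * (n₁ * n₁) + i
  bit_eq : ∀ l < (j + 1) * (n₁ * n₁) + i, s.arr .bit l = cellValue T m n₁ l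
  g_iff : s.reg .g ≠ 0 ↔ ∃ l < i, cellValue T m n₁ (j * (n₁ * n₁) + l) ≠ 0

theorem Scan.congr {i : ℕ} (h : Scan T m n₁ j i s) {s' : Store Reg Arr}
    (h₁ : s'.arr .bit = s.arr .bit) (h₂ : ∀ r ∈ [Reg.d, .e, .g], s'.reg r = s.reg r) :
    Scan T m n₁ j i s' :=
  ⟨by rw [h₂ _ (by simp), h.d_eq], by rw [h₂ _ (by simp), h.e_eq], by rw [h₁]; exact h.bit_eq,
    by rw [h₂ _ (by simp)]; exact h.g_iff⟩

/-- All tables lie one after the other in a single array. New entries are appended at `e`, while `d`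
rereads the current table to detect a nonzero entry. -/
theorem eval_nextCell (hC : Context T m n₁ j s) (hx : s.reg .x = x) (hy : s.reg .y = y)
    (hxn : x < n₁) (hyn : y < n₁) (hn : n₁ ≤ N) (hm : m ≤ N) (hT : ∀ i, T i < n₁)
    (h : Scan T m n₁ j (x * n₁ + y) s) :
    Scan T m n₁ j (x * n₁ + y + 1) (eval N nextCell s) := by
  have hc := cell_lt hxn hyn
  have hjK : (j + 1) * (n₁ * n₁) = j * (n₁ * n₁) + n₁ * n₁ := by ring
  simp only [nextCell, eval_block_cons, eval_block_nil]
  set s₁ := eval N (.zero .w) (eval N (.inc .d) (eval N (.ifZero .v .skip (setOne .g))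
    (eval N (.read .v .bit .u) (eval N (.copy .u .d) s)))) with hs₁
  have gg : s₁.reg .g = if cellValue T m n₁ (j * (n₁ * n₁) + (x * n₁ + y)) = 0 then s.reg .g
      else 1 := by
    rw [← h.bit_eq _ (by omega), ← h.d_eq]
    simp only [hs₁, eval, setOne, block, List.foldr]
    simp
    split_ifs <;> simp
  have g₁ : s₁.reg .g ≠ 0 ↔
      ∃ l < x * n₁ + y + 1, cellValue T m n₁ (j * (n₁ * n₁) + l) ≠ 0 := by
    rw [exists_lt_succ_iff, ← h.g_iff, gg]
    split_ifs with h₀ <;> simp [h₀]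
  have fr : ∀ r, r ∉ [Reg.u, .v, .g, .d, .w] → s₁.reg r = s.reg r := by
    intro r hr
    simp only [List.mem_cons, List.not_mem_nil, or_false, not_or] at hr
    simp only [hs₁, eval, setOne, block, List.foldr]
    split_ifs <;> simp [hr]
  have d₁ : s₁.reg .d = j * (n₁ * n₁) + (x * n₁ + y) + 1 := by
    rw [← h.d_eq]
    simp only [hs₁, eval, setOne, block, List.foldr]
    split_ifs <;> simp
  have w₁ : s₁.reg .w = 0 := by simp [hs₁, eval]
  have a₁ : s₁.arr = s.arr := by
    simp only [hs₁, eval, setOne, block, List.foldr]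
    split_ifs <;> simp
  have w₂ := eval_letters (N := N) (hC.congr (s' := s₁) (by rw [a₁]) (fun r hr => fr r (by
    simp only [List.mem_cons, List.not_mem_nil, or_false] at hr
    rcases hr with rfl | rfl | rfl <;> simp)))
    (by rw [fr _ (by simp), hx]) (by rw [fr _ (by simp), hy]) hxn hyn hn hm hT
    (fun i hi => by rw [a₁]; exact h.bit_eq i (by omega)) w₁
  set s₂ := eval N (forTo .a .t₃ .m testLetter) s₁ with hs₂
  have a₂ : s₂.arr = s.arr := by
    rw [← a₁]
    funext a
    exact eval_arr_of_notMem _ (by revert a; decide) s₁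
  have fr₂ : ∀ r ∈ [Reg.d, .e, .g], s₂.reg r = s₁.reg r := by
    intro r hr
    exact eval_reg_of_notMem _ (by revert r; decide) s₁
  refine ⟨?_, ?_, ?_, ?_⟩
  · simp [eval, fr₂, d₁, Nat.add_assoc]
  · simp [eval, fr₂, fr, h.e_eq, Nat.add_assoc]
  · intro l hl
    have hb := h.bit_eq l
    simp only [eval, Store.setReg_arr, Store.setArr_arr_self, update_apply, a₂]
    simp only [Store.setReg_reg_self, Store.setReg_reg_of_ne, ne_eq, reduceCtorEq,
        not_false_eq_true, w₂, fr₂ .e (by simp), fr .e (by simp), h.e_eq]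
    split_ifs with h'
    · rw [h']
    · exact hb (by omega)
  · simpa [eval, fr₂] using g₁

theorem eval_row (hC : Context T m n₁ j s) (hx : s.reg .x = x) (hxn : x < n₁) (hn : n₁ ≤ N)
    (hm : m ≤ N) (hT : ∀ i, T i < n₁) (h : Scan T m n₁ j (x * n₁) s) :
    Scan T m n₁ j ((x + 1) * n₁) (eval N (forTo .y .t₂ .n₁ nextCell) s) := by
  have key := eval_forTo_induction (N := N) (P := nextCell) (s := s) (x := .y) (t := .t₂)
    (b := .n₁) (fun i s' => Scan T m n₁ j (x * n₁ + i) s')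
    (by simp) (by simp) (by simp) (by decide) (by decide) (by rw [hC.n₁_eq]; exact hn)
    (h.congr rfl (by simp)) (fun i s' hi h hy hr hra => by
      rw [hC.n₁_eq] at hi
      have fr : ∀ r ∈ [Reg.x, .m, .n₁, .base], s'.reg r = s.reg r := by
        intro r hr'
        exact hr r (by revert r; decide) (by revert r; decide) (by revert r; decide)
      refine (eval_nextCell (N := N) (x := x) (y := i)
        (hC.congr (s' := s'.setReg .t₂ (s.reg .n₁ - (i + 1))) (hra .tab (by decide))
          (fun r hr' => ?_)) ?_ ?_ hxn hi hn hm hT (h.congr rfl (by simp))).congr rfl (by simp)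
      · rw [Store.setReg_reg_of_ne _ (by revert r; decide)]
        exact fr r (by revert r; decide)
      · simp [fr, hx]
      · simp [hy])
  rw [hC.n₁_eq] at key
  rw [Nat.add_mul, Nat.one_mul]
  exact key

theorem eval_rows (hC : Context T m n₁ j s) (hn : n₁ ≤ N) (hm : m ≤ N) (hT : ∀ i, T i < n₁)
    (h : Scan T m n₁ j 0 s) :
    Scan T m n₁ j (n₁ * n₁) (eval N (forTo .x .t₁ .n₁ (forTo .y .t₂ .n₁ nextCell)) s) := by
  have key := eval_forTo_induction (N := N) (P := forTo .y .t₂ .n₁ nextCell) (s := s) (x := .x)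
    (t := .t₁) (b := .n₁) (fun i s' => Scan T m n₁ j (i * n₁) s')
    (by simp) (by simp) (by simp) (by decide) (by decide) (by rw [hC.n₁_eq]; exact hn)
    (by rw [Nat.zero_mul]; exact h.congr rfl (by simp)) (fun i s' hi h hx hr hra => by
      rw [hC.n₁_eq] at hi
      refine (eval_row (N := N) (x := i)
        (hC.congr (s' := s'.setReg .t₁ (s.reg .n₁ - (i + 1))) (hra .tab (by decide))
          (fun r hr' => ?_)) ?_ hi hn hm hT (h.congr rfl (by simp))).congr rfl (by simp)
      · rw [Store.setReg_reg_of_ne _ (by revert r; decide)]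
        exact hr r (by revert r; decide) (by revert r; decide) (by revert r; decide)
      · simp [hx])
  rw [hC.n₁_eq] at key
  exact key

/-- Some pair of states is split by a word of length `j`. -/
def SplitAt (T : ℕ → ℕ) (m n₁ j : ℕ) : Prop := ∃ x < n₁, ∃ y < n₁, PairBit T m j x y

open Classical in
/-- The `j`-th table has been computed, and the tables before it have been counted in `k`. -/
structure Table (T : ℕ → ℕ) (m n₁ j : ℕ) (s : Store Reg Arr) : Prop extends
    Context T m n₁ j s where
  e_eq : s.reg .e = (j + 1) * (n₁ * n₁)
  bit_eq : ∀ l < (j + 1) * (n₁ * n₁), s.arr .bit l = cellValue T m n₁ l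
  k_eq : s.reg .k = Nat.count (SplitAt T m n₁) j
  g_iff : 0 < j → (s.reg .g ≠ 0 ↔ SplitAt T m n₁ (j - 1))

theorem eval_nextTable (hn : n₁ ≤ N) (hm : m ≤ N) (hT : ∀ i, T i < n₁) (h : Table T m n₁ j s) :
    Table T m n₁ (j + 1) (eval N nextTable s) := by
  have hjK : (j + 1) * (n₁ * n₁) = j * (n₁ * n₁) + n₁ * n₁ := by ring
  simp only [nextTable, eval_block_cons, eval_block_nil]
  set s₁ := eval N (.copy .d .base) (eval N (.zero .g) s) with hs₁
  have fr₁ : ∀ r, r ∉ [Reg.g, .d] → s₁.reg r = s.reg r := by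
    intro r hr
    simp only [List.mem_cons, List.not_mem_nil, or_false, not_or] at hr
    simp [hs₁, eval, hr]
  have hC : Context T m n₁ j s₁ := h.toContext.congr rfl (fun r hr => fr₁ r (by
    revert r; decide))
  have key := eval_rows (N := N) hC hn hm hT
    ⟨by simp [hs₁, eval, h.base_eq], by rw [fr₁ _ (by simp), h.e_eq, Nat.add_zero (_ * _)],
      h.bit_eq, by simp [hs₁, eval]⟩
  have fr₂ : ∀ r ∈ [Reg.m, .n₁, .k], (eval N (forTo .x .t₁ .n₁ (forTo .y .t₂ .n₁ nextCell))
      s₁).reg r = s.reg r := by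
    intro r hr
    rw [eval_reg_of_notMem _ (by revert r; decide), fr₁ _ (by revert r; decide)]
  have a₂ : (eval N (forTo .x .t₁ .n₁ (forTo .y .t₂ .n₁ nextCell)) s₁).arr .tab = T := by
    rw [eval_arr_of_notMem _ (by decide), hC.tab_eq]
  set s₂ := eval N (forTo .x .t₁ .n₁ (forTo .y .t₂ .n₁ nextCell)) s₁ with hs₂
  have hg := key.g_iff
  rw [exists_cellValue_ne_zero] at hg
  have fr₃ : ∀ r, r ∉ [Reg.base, .k] →
      (eval N (.ifZero .g .skip (.inc .k)) (eval N (.copy .base .d) s₂)).reg r = s₂.reg r := by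
    intro r hr
    rw [eval_reg_of_notMem _ (by revert r; decide), eval_reg_of_notMem _ (by revert r; decide)]
  have a₃ : (eval N (.ifZero .g .skip (.inc .k)) (eval N (.copy .base .d) s₂)).arr = s₂.arr := by
    funext a
    rw [eval_arr_of_notMem _ (by simp [modArr]), eval_arr_of_notMem _ (by simp [modArr])]
  refine ⟨⟨?_, ?_, ?_, ?_⟩, ?_, ?_, ?_, fun _ => ?_⟩
  · rw [a₃, a₂]
  · rw [fr₃ _ (by simp), fr₂ _ (by simp), h.m_eq]
  · rw [fr₃ _ (by simp), fr₂ _ (by simp), h.n₁_eq]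
  · rw [hjK, ← key.d_eq, eval_reg_of_notMem _ (by decide)]
    simp [eval]
  · rw [fr₃ _ (by simp), key.e_eq]
    ring
  · rw [a₃]
    intro l hl
    exact key.bit_eq l (by rw [Nat.add_mul, Nat.one_mul] at hl; exact hl)
  · rw [Nat.count_succ, ← h.k_eq, ← fr₂ .k (by simp)]
    have e : (eval N (.copy .base .d) s₂).reg .g = s₂.reg .g := by simp [eval]
    have e' : (eval N (.copy .base .d) s₂).reg .k = s₂.reg .k := by simp [eval]
    generalize eval N (.copy .base .d) s₂ = s₃ at e e' ⊢
    by_cases h₁ : SplitAt T m n₁ j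
    · simp [eval, e, hg.2 h₁, e', h₁]
    · simp [eval, e, not_not.1 (mt hg.1 h₁), e', h₁]
  · rw [fr₃ _ (by simp), hg, Nat.add_sub_cancel]
    rfl

theorem eval_loop_nextTable (hn : n₁ ≤ N) (hm : m ≤ N) (hT : ∀ i, T i < n₁)
    (h : Table T m n₁ 0 s) : Table T m n₁ (N * N) (eval N (.loop (.loop nextTable)) s) := by
  refine eval_loop_induction (fun i s' => Table T m n₁ (i * N) s') (by rwa [Nat.zero_mul])
    (fun i s' _ h _ _ => ?_)
  rw [Nat.add_mul, Nat.one_mul]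
  exact eval_loop_induction (fun i' s' => Table T m n₁ (i * N + i') s') h
    (fun i s' _ h _ _ => eval_nextTable hn hm hT h)

/-- `firstTable` has computed `i` entries. -/
structure FirstScan (T : ℕ → ℕ) (m n₁ i : ℕ) (s : Store Reg Arr) : Prop where
  e_eq : s.reg .e = i
  bit_eq : ∀ l < i, s.arr .bit l = cellValue T m n₁ l

/-- Comparison is done by truncated subtraction: `d = x - y` is nonzero exactly when `y < x`, and
decrementing it follows the increase of `y`. Testing only one order suffices, since the tables
contain both orders of each pair. -/
theorem eval_firstCell (hd : s.reg .d = x - y) (hy : s.reg .y = y) (hxn : x < n₁) (hyn : y < n₁)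
    (h : FirstScan T m n₁ (x * n₁ + y) s) :
    FirstScan T m n₁ (x * n₁ + y + 1) (eval N firstCell s) ∧
      (eval N firstCell s).reg .d = x - (y + 1) := by
  have hc : cellValue T m n₁ (x * n₁ + y) = if 0 < y ∧ y < x then 1 else 0 := by
    have := cellValue_cell (T := T) (m := m) (j := 0) hxn hyn
    rw [Nat.zero_mul, Nat.zero_add] at this
    rw [this]
    by_cases h : 0 < y ∧ y < x
    · rw [if_pos (show PairBit T m 0 x y from h), if_pos h]
    · rw [if_neg (show ¬ PairBit T m 0 x y from h), if_neg h]
  simp only [firstCell, eval_block_cons, eval_block_nil]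
  set s₁ := eval N (.ifZero .d .skip (.ifZero .y .skip (.inc .w))) (eval N (.zero .w) s) with hs₁
  have fr : ∀ r, r ≠ .w → s₁.reg r = s.reg r := by
    intro r hr
    rw [hs₁, eval_reg_of_notMem _ (by simp [modReg, hr]), eval_reg_of_notMem _ (by
      simp [modReg, hr])]
  have a₁ : s₁.arr = s.arr := by
    funext a
    rw [hs₁, eval_arr_of_notMem _ (by simp [modArr]), eval_arr_of_notMem _ (by simp [modArr])]
  have w₁ : s₁.reg .w = cellValue T m n₁ (x * n₁ + y) := by
    rw [hc]
    simp only [hs₁, eval, Store.setReg_reg_of_ne, ne_eq, reduceCtorEq, not_false_eq_true, hd, hy]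
    split_ifs <;> first | omega | simp
  refine ⟨⟨?_, fun l hl => ?_⟩, ?_⟩
  · simp [eval, fr, h.e_eq]
  · simp only [eval, Store.setReg_arr, Store.setArr_arr_self, update_apply, a₁]
    simp only [Store.setReg_reg_self, Store.setReg_reg_of_ne, ne_eq, reduceCtorEq,
      not_false_eq_true, w₁, fr .e (by simp), h.e_eq]
    split_ifs with h'
    · rw [h']
    · exact h.bit_eq l (by omega)
  · simp [eval, fr, hd, Nat.sub_sub]

theorem eval_firstTable (hn₁ : s.reg .n₁ = n₁) (hn : n₁ ≤ N) :
    FirstScan T m n₁ (n₁ * n₁) (eval N firstTable s) := by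
  simp only [firstTable, eval_block_cons, eval_block_nil]
  have e₀ : (eval N (.zero .e) s).reg .n₁ = n₁ := by simp [eval, hn₁]
  have key := eval_forTo_induction (N := N) (x := .x) (t := .t₁) (b := .n₁)
    (P := block [.copy .d .x, forTo .y .t₂ .n₁ firstCell]) (s := eval N (.zero .e) s)
    (fun i s' => FirstScan T m n₁ (i * n₁) s')
    (by simp) (by simp) (by simp) (by decide) (by decide) (by rw [e₀]; exact hn)
    ⟨by simp [eval], by simp⟩ (fun i s' hi h hx hr _ => by
      rw [e₀] at hi
      simp only [eval_block_cons, eval_block_nil]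
      set s₁ := eval N (.copy .d .x) (s'.setReg .t₁ ((eval N (.zero .e) s).reg .n₁ - (i + 1)))
        with hs₁
      have nn₁ : s₁.reg .n₁ = n₁ := by
        have := hr .n₁ (by simp) (by simp) (by decide)
        simp [hs₁, eval, this, hn₁]
      have d₁ : s₁.reg .d = i := by simp [hs₁, eval, hx]
      have key := eval_forTo_induction (N := N) (x := .y) (t := .t₂) (b := .n₁) (P := firstCell)
        (s := s₁) (fun i' s' => FirstScan T m n₁ (i * n₁ + i') s' ∧ s'.reg .d = i - i')
        (by simp) (by simp) (by simp) (by decide) (by decide) (by rw [nn₁]; exact hn)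
        ⟨⟨by simp [hs₁, eval, h.e_eq], by simpa [hs₁, eval] using h.bit_eq⟩, by simp [d₁]⟩
        (fun i' s' hi' h hy _ _ => by
          rw [nn₁] at hi'
          obtain ⟨h₁, h₂⟩ := eval_firstCell (N := N) (T := T) (m := m) (x := i) (y := i')
            (s := s'.setReg .t₂ (s₁.reg .n₁ - (i' + 1))) (by simp [h.2]) (by simp [hy]) hi hi'
            ⟨by simp [h.1.e_eq], h.1.bit_eq⟩
          exact ⟨⟨by rw [Store.setReg_reg_of_ne _ (by simp), h₁.e_eq, Nat.add_assoc], h₁.bit_eq⟩,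
            by rw [Store.setReg_reg_of_ne _ (by simp), h₂]⟩)
      rw [nn₁] at key
      rw [Nat.add_mul, Nat.one_mul]
      exact ⟨by rw [Store.setReg_reg_of_ne _ (by simp), key.1.e_eq], key.1.bit_eq⟩)
  rw [e₀] at key
  exact key

open Classical in
-- After `N * N` rounds `k` has counted the tables of index below `N * N`, and `g` still tells
-- whether the last of these was nonempty. The positive length ensures that there is a last one. Of
-- the two increments at the end, one turns the count into the order and one is the shift in
-- encoding an optional number.
theorem eval_main (hN : 0 < N) (hn₁ : (eval N readInput s).reg .n₁ = n₁)
    (hm : (eval N readInput s).reg .m = m) (hT : (eval N readInput s).arr .tab = T)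
    (hnN : n₁ ≤ N) (hmN : m ≤ N) (hTn : ∀ i, T i < n₁) :
    (eval N main s).reg .out = if SplitAt T m n₁ (N * N - 1) then 0 else
      Nat.count (SplitAt T m n₁) (N * N) + 2 := by
  simp only [main, eval_block_cons, eval_block_nil]
  set s₁ := eval N readInput s
  have h₂ : FirstScan T m n₁ (n₁ * n₁) (eval N firstTable s₁) := eval_firstTable hn₁ hnN
  have fr₂ : ∀ r ∈ [Reg.m, .n₁], (eval N firstTable s₁).reg r = s₁.reg r :=
    fun r hr => eval_reg_of_notMem _ (by revert r; decide) _
  have a₂ : (eval N firstTable s₁).arr .tab = s₁.arr .tab := eval_arr_of_notMem _ (by decide) _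
  have h₃ : Table T m n₁ 0 (eval N (.zero .k) (eval N (.zero .base) (eval N firstTable s₁))) :=
    ⟨⟨by simp [eval, a₂, hT], by simp [eval, fr₂, hm], by simp [eval, fr₂, hn₁],
      by simp [eval]⟩, by simp [eval, h₂.e_eq], by simpa [eval] using h₂.bit_eq,
      by simp [eval], by simp⟩
  have h₄ := eval_loop_nextTable hnN hmN hTn h₃
  have hg := h₄.g_iff (Nat.mul_pos hN hN)
  rw [← h₄.k_eq]
  generalize eval N (.loop (.loop nextTable)) _ = s₄ at hg
  by_cases h₅ : SplitAt T m n₁ (N * N - 1)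
  · simp [eval, hg.2 h₅, h₅]
  · simp [eval, not_not.1 (mt hg.1 h₅), h₅]

end OrderProgram

/-! ### From the encoded automaton to the numerical tables -/

namespace FinAutomaton

open StackProgram (encodeList encodeList_nil encodeList_cons)
open OrderProgram (PairBit SplitAt)
open LoopCommand (eval inputStore)

variable (A : FinAutomaton)

/-- The number by which an entry of the transition table is encoded. -/
def code {n : ℕ} (o : Option (Fin n)) : ℕ := o.elim 0 fun p => p + 1

theorem code_lt {n : ℕ} (o : Option (Fin n)) : code o < n + 1 := by
  cases o with
  | none => exact Nat.succ_pos n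
  | some p => exact Nat.succ_lt_succ p.2

theorem encodeOptionNat_map_val {n : ℕ} (o : Option (Fin n)) :
    encodeOptionNat (o.map Fin.val) = encodeUnary (code o) := by
  cases o <;> rfl

/-- The codes of the entries of the transition table, row by row. -/
def entries : List ℕ := List.ofFn fun i : Fin (A.n * A.m) => code (A.step i.divNat i.modNat)

theorem step_divNat_modNat (p : Fin A.n) (a : Fin A.m) (h : p * A.m + a < A.n * A.m) :
    A.step (Fin.divNat ⟨p * A.m + a, h⟩) (Fin.modNat ⟨p * A.m + a, h⟩) = A.step p a := by
  congr 1
  · refine Fin.ext ?_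
    simp [Fin.divNat, Nat.add_comm _ (a : ℕ), Nat.add_mul_div_right _ _ a.pos]
  · refine Fin.ext ?_
    simp [Fin.modNat, Nat.add_comm _ (a : ℕ), Nat.mod_eq_of_lt a.2]

theorem length_entries : A.entries.length = A.n * A.m := List.length_ofFn

theorem getD_entries (p : Fin A.n) (a : Fin A.m) :
    A.entries.getD (p * A.m + a) 0 = code (A.step p a) := by
  have h : p * A.m + a < A.n * A.m := by
    have := Nat.mul_le_mul_right A.m (Nat.succ_le_of_lt p.2)
    rw [Nat.succ_mul] at this
    omega
  rw [List.getD_eq_getElem _ _ (by rwa [length_entries])]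
  simp only [entries, List.getElem_ofFn]
  rw [step_divNat_modNat]

theorem encodeList_entries : encodeList A.entries = (List.finRange A.n).flatMap fun p =>
    (List.finRange A.m).flatMap fun a => encodeOptionNat ((A.step p a).map Fin.val) := by
  have h : A.entries = (List.finRange A.n).flatMap fun p =>
      (List.finRange A.m).map fun a => code (A.step p a) := by
    rw [entries, List.ofFn_mul, List.flatMap_def, List.ofFn_eq_map]
    congr 2
    funext p
    rw [List.ofFn_eq_map]
    congr 1
    funext a
    exact congrArg code (A.step_divNat_modNat p a _)
  simp only [h, encodeList, List.flatMap_assoc, List.flatMap_map, encodeOptionNat_map_val]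

theorem encode_eq : A.encode = encodeUnary A.n ++ (encodeUnary A.m ++ (encodeUnary A.start ++
    ((List.finRange A.n).map A.accept ++ encodeList A.entries))) := by
  simp only [encode, encodeList_entries, List.append_assoc]

theorem length_le_length_encodeList (l : List ℕ) : l.length ≤ (encodeList l).length := by
  induction l with
  | nil => simp
  | cons a l ih => simp only [encodeList_cons, List.length_append, List.length_cons]; omega

theorem bounds_encode : A.n + 1 ≤ A.encode.length ∧ A.m ≤ A.encode.length ∧
    A.entries.length ≤ A.encode.length := by
  have := length_le_length_encodeList A.entries
  simp only [encode_eq, encodeUnary, List.length_append, List.length_replicate,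
    List.length_singleton]
  omega

/-- The transition table with an empty row for the missing states. -/
def table (i : ℕ) : ℕ := if A.m ≤ i then A.entries.getD (i - A.m) 0 else 0

theorem table_lt (i : ℕ) : A.table i < A.n + 1 := by
  unfold table
  split_ifs
  · rcases Nat.lt_or_ge (i - A.m) A.entries.length with h | h
    · rw [List.getD_eq_getElem _ _ h]
      simp only [entries, List.getElem_ofFn]
      exact code_lt _
    · rw [List.getD_eq_default _ _ h]
      omega
  · omega

theorem table_zero {a : ℕ} (ha : a < A.m) : A.table (0 * A.m + a) = 0 := by
  rw [table, if_neg (by omega)]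

theorem table_succ (p : Fin A.n) (a : Fin A.m) :
    A.table ((p + 1) * A.m + a) = code (A.step p a) := by
  have h : ((p : ℕ) + 1) * A.m + a = A.m + (p * A.m + a) := by ring
  rw [table, h, if_pos (by omega), Nat.add_sub_cancel_left, getD_entries]

theorem code_eq_succ {n : ℕ} {o : Option (Fin n)} {p : Fin n} : code o = p + 1 ↔ o = some p := by
  cases o with
  | none => simp [code]
  | some q => simp [code, Fin.ext_iff]

/-- Code zero leads only to zero, and the initial table demands positive codes, so a pair that has
run into a missing edge never counts as split. -/
theorem pairBit_iff (j : ℕ) {x y : ℕ} (hx : x < A.n + 1) (hy : y < A.n + 1) :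
    PairBit A.table A.m j x y ↔ ∃ p q : Fin A.n, x = p + 1 ∧ y = q + 1 ∧
      ∃ w : List (Fin A.m), w.length = j ∧ ∃ p' q', A.run p w = some p' ∧ A.run q w = some q' ∧
        q' < p' := by
  induction j generalizing x y with
  | zero =>
    constructor
    · rintro ⟨h₁, h₂⟩
      refine ⟨⟨x - 1, by omega⟩, ⟨y - 1, by omega⟩, by simp; omega, by simp; omega, [], rfl, _, _,
        rfl, rfl, ?_⟩
      rw [Fin.lt_def]
      simp
      omega
    · rintro ⟨p, q, rfl, rfl, w, hw, p', q', hp, hq, h⟩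
      obtain rfl := List.length_eq_zero_iff.1 hw
      rw [run_nil, Option.some.injEq] at hp hq
      subst hp hq
      exact ⟨Nat.succ_pos _, Nat.succ_lt_succ h⟩
  | succ j ih =>
    constructor
    · rintro ⟨a, ha, h⟩
      obtain ⟨p₁, q₁, h₁, h₂, w, hw, p', q', hp, hq, hlt⟩ :=
        (ih (A.table_lt _) (A.table_lt _)).1 h
      rcases Nat.eq_zero_or_pos x with rfl | hx₀
      · rw [A.table_zero ha] at h₁
        omega
      rcases Nat.eq_zero_or_pos y with rfl | hy₀
      · rw [A.table_zero ha] at h₂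
        omega
      obtain ⟨p, rfl⟩ : ∃ p : Fin A.n, x = p + 1 := ⟨⟨x - 1, by omega⟩, by simp; omega⟩
      obtain ⟨q, rfl⟩ : ∃ q : Fin A.n, y = q + 1 := ⟨⟨y - 1, by omega⟩, by simp; omega⟩
      rw [A.table_succ p ⟨a, ha⟩, code_eq_succ] at h₁
      rw [A.table_succ q ⟨a, ha⟩, code_eq_succ] at h₂
      exact ⟨p, q, rfl, rfl, ⟨a, ha⟩ :: w, by simp [hw], p', q', by simp [run_cons, h₁, hp],
        by simp [run_cons, h₂, hq], hlt⟩
    · rintro ⟨p, q, rfl, rfl, w, hw, p', q', hp, hq, hlt⟩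
      cases w with
      | nil => simp at hw
      | cons a w =>
        rw [run_cons] at hp hq
        obtain ⟨p₁, hp₁, hp⟩ := Option.bind_eq_some_iff.1 hp
        obtain ⟨q₁, hq₁, hq⟩ := Option.bind_eq_some_iff.1 hq
        refine ⟨a, a.2, (ih (A.table_lt _) (A.table_lt _)).2 ⟨p₁, q₁, ?_, ?_, w, by simpa using hw,
          p', q', hp, hq, hlt⟩⟩
        · rw [A.table_succ, code_eq_succ, hp₁]
        · rw [A.table_succ, code_eq_succ, hq₁]

/-- Two distinct end states are in decreasing order after possibly exchanging the two starting
states. -/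
theorem splitAt_iff (j : ℕ) : SplitAt A.table A.m (A.n + 1) j ↔ A.HasSplit j := by
  constructor
  · rintro ⟨x, hx, y, hy, h⟩
    obtain ⟨p, q, -, -, w, hw, p', q', hp, hq, hlt⟩ := (A.pairBit_iff j hx hy).1 h
    exact ⟨w, hw, p, q, p', q', hp, hq, hlt.ne'⟩
  · rintro ⟨w, hw, p, q, p', q', hp, hq, hne⟩
    have hp₀ := Nat.succ_lt_succ p.2
    have hq₀ := Nat.succ_lt_succ q.2
    rcases hne.lt_or_gt with h | h
    · exact ⟨_, hq₀, _, hp₀, (A.pairBit_iff j hq₀ hp₀).2 ⟨q, p, rfl, rfl, w, hw, q', p', hq, hp, h⟩⟩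
    · exact ⟨_, hp₀, _, hq₀, (A.pairBit_iff j hp₀ hq₀).2 ⟨p, q, rfl, rfl, w, hw, p', q', hp, hq, h⟩⟩

theorem encodeOptionNat_order (hR : A.IsReduced) (hS : A.IsStronglyConnected) :
    encodeOptionNat A.order = encodeUnary ((eval A.encode.length OrderProgram.main
      (inputStore .inp A.encode)).reg .out) := by
  classical
  obtain ⟨hn, hm, hv⟩ := A.bounds_encode
  obtain ⟨-, m₁, n₁, t₁, -⟩ := OrderProgram.eval_readInput A.encode_eq (by simp) hv rfl
  -- The unary number of states alone takes n + 1 bits, so N² ≥ (n + 1)² > n², and the last table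
  -- counted has index at least n².
  have hJ : A.n * A.n ≤ A.encode.length * A.encode.length - 1 := by
    have := Nat.mul_le_mul hn hn
    rw [Nat.succ_mul, Nat.mul_succ] at this
    omega
  have hN : 0 < A.encode.length := by omega
  rw [OrderProgram.eval_main hN n₁ m₁ t₁ hn hm A.table_lt, A.order_eq hR hS hJ,
    Nat.sub_add_cancel (Nat.mul_pos hN hN)]
  have e : SplitAt A.table A.m (A.n + 1) = A.HasSplit := funext fun j => propext (A.splitAt_iff j)
  change _ = encodeUnary (if SplitAt A.table A.m (A.n + 1) _ then 0 else
    Nat.count (SplitAt A.table A.m (A.n + 1)) _ + 2)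
  simp only [e]
  split_ifs <;> rfl

end FinAutomaton

/-- The program never tests reducedness or strong connectedness; they enter only in identifying its
output with the order. -/
theorem mainTheorem9 :
    Nonempty (Turing.TM2ComputableInPolyTime
      (fun A : {A : FinAutomaton // A.IsReduced ∧ A.IsStronglyConnected} => A.1.encode)
      encodeOptionNat
      (fun A : {A : FinAutomaton // A.IsReduced ∧ A.IsStronglyConnected} => A.1.order)) :=
  LoopCommand.nonempty_computableInPolyTime OrderProgram.main .inp .out _ _ _
    fun A => A.1.encodeOptionNat_order A.2.1 A.2.2
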